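/- **Setting.** Let $(\Omega,\mathcal F_T,P)$ be a probability space, $Q\sim P$ an equivalent probability measure, $T>0$, $r$ an integrable deterministic short rate on $[0,T]$, and let $\xi_T=e^{-\int_0^T r_s\,ds}\,\frac{dQ}{dP}$ be the state price density of a complete market; assume that $P(\xi_T=c)=0$ for every $c\in\mathbb R$. Let $U:[0,\infty)\to\mathbb R$ be continuous, strictly increasing and strictly concave, continuously differentiable on $(0,\infty)$, with $U(0)=0$, $U'(0+)=\infty$, $U'(\infty)=0$ and $\limsup_{x\to\infty}xU'(x)/U(x)<1$; let $I$ be the inverse function of $U':(0,\infty)\to(0,\infty)$, and assume $E[U(I(\lambda\xi_T))]<\infty$ and $E[\xi_TI(\lambda\xi_T)]<\infty$ for all $\lambda>0$. Let $D_T>0$, $L>0$ and $0<\epsilon<Le^{-\int_0^Tr_s\,ds}$, and put $x_0^{min}=Le^{-\int_0^Tr_s\,ds}-\epsilon$. By completeness, the terminal wealths attainable from $x_0$ are the $\mathcal F_T$-measurable $X_T\ge0$ with $E[\xi_TX_T]=x_0$. The ES-constrained problem is to maximize $E[U((X_T-D_T)^+)]$ over attainable $X_T$ subject to $E[\xi_T(L-X_T)\mathbf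 1_{X_T<L}]\le\epsilon$ and $E[\xi_TX_T]\le x_0$. "Optimal" means: feasible, with finite expected utility, and with expected utility at least that of every feasible wealth (optima need not be unique). For $d>0$, the tangent point with respect to $d$ is the $\hat d>d$ with $U(\hat d-d)/\hat d=U'(\hat d-d)$. Let $\hat D_T$ be the tangent point with respect to $D_T$ and, if $L<D_T$, $\tilde L$ the one with respect to $D_T-L$. Let $\bar\xi_\epsilon>0$ satisfy $E[L\xi_T\mathbf 1_{\xi_T\ge\bar\xi_\epsilon}]=\epsilon$. If $L>\hat D_T$, let $\bar\lambda>0$ satisfy $$E\big[\xi_T(L-I(\bar\lambda\xi_T)-D_T)\mathbf 1_{U'(\hat D_T-D_T)>\xi_T\bar\lambda\ge U'(L-D_T)}+\xi_TL\,\mathbf 1_{\xi_T\bar\lambda\ge U'(\hat D_T-D_T)}\big]=\epsilon .$$ For $\lambda>0$ write $X^{B}_\lambda=(I(\lambda\xi_T)+D_T)\mathbf 1_{\xi_T<U'(\hat D_T-D_T)/\lambda}$ (the form of the unconstrained benchmark). **Theorem.** The points $\hat D_T$ and (if $L<D_T$) $\tilde L$ exist and are unique, and $\bar\xi_\epsilon$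 and (if $L>\hat D_T$) $\bar\lambda$ exist. For every choice of these quantities and every $x_0\ge x_0^{min}$ the following holds. a) Let $L\le D_T$ and $x_0^1=E[\xi_T(I(U'(\hat D_T-D_T)\xi_T/\bar\xi_\epsilon)+D_T)\mathbf 1_{\xi_T<\bar\xi_\epsilon}]$. For $\lambda>0$ let $\xi^{\tilde L}=U'(\tilde L-(D_T-L))/\lambda$ if $L<D_T$ and $\xi^{\tilde L}=\infty$ if $L=D_T$, and let $$X_\lambda=\begin{cases}(I(\lambda\xi_T)+D_T)\mathbf 1_{\xi_T<\bar\xi_\epsilon}&\text{if }\bar\xi_\epsilon\le\xi^{\tilde L},\\ (I(\lambda\xi_T)+D_T)\mathbf 1_{\xi_T<\xi^{\tilde L}}+L\mathbf 1_{\xi^{\tilde L}\le\xi_T<\bar\xi_\epsilon}&\text{if }\bar\xi_\epsilon>\xi^{\tilde L}.\end{cases}$$ i) If $x_0^{min}\le x_0<x_0^1$, then $X_\lambda$ is optimal for every $\lambda>0$ with $E[\xi_TX_\lambda]=x_0$; such a $\lambda$ exists if $x_0>x_0^{min}$; if $x_0=x_0^{min}$, the limit $L\mathbf 1_{\xi_T<\bar\xi_\epsilon}$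 as $\lambda\to\infty$ is optimal. ii) If $x_0\ge x_0^1$, there is a $\lambda>0$ with $E[\xi_TX^B_\lambda]=x_0$, and $X^B_\lambda$ is optimal for every such $\lambda$. b) Let $D_T<L\le\hat D_T$ and $x_0^2=E[\xi_T(I(U'(\hat D_T-D_T)\xi_T/\bar\xi_\epsilon)+D_T)\mathbf 1_{\xi_T<\bar\xi_\epsilon}]$. For $\lambda>0$ let $\underline\xi=U'(L-D_T)/\lambda$ and $$X_\lambda=\begin{cases}(I(\lambda\xi_T)+D_T)\mathbf 1_{\xi_T<\bar\xi_\epsilon}&\text{if }\bar\xi_\epsilon<\underline\xi,\\ (I(\lambda\xi_T)+D_T)\mathbf 1_{\xi_T<\underline\xi}+L\mathbf 1_{\underline\xi\le\xi_T<\bar\xi_\epsilon}&\text{if }\bar\xi_\epsilon\ge\underline\xi.\end{cases}$$ Then i) and ii) of a) hold with this $X_\lambda$ and with $x_0^2$ in place of $x_0^1$. c) Let $L>\hat D_T$ and $x_0^3=E[\xi_T(I(\bar\lambda\xi_T)+D_T)\mathbf 1_{\xi_T\bar\lambda<U'(\hat D_T-D_T)}]$. For $0\le\lambda_2<\lambda$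 let $\underline\xi=\frac{U'(L-D_T)}{\lambda}$, $\bar{\bar\xi}=\frac{U'(L-D_T)}{\lambda-\lambda_2}$, $\xi^{\hat D_T}=\frac{U'(\hat D_T-D_T)}{\lambda-\lambda_2}$ and $$X_{\lambda,\lambda_2}=(I(\lambda\xi_T)+D_T)\mathbf 1_{\xi_T<\underline\xi}+L\mathbf 1_{\underline\xi\le\xi_T<\bar{\bar\xi}}+(I((\lambda-\lambda_2)\xi_T)+D_T)\mathbf 1_{\bar{\bar\xi}\le\xi_T<\xi^{\hat D_T}} .$$ i) If $x_0^{min}\le x_0<x_0^3$, then $X_{\lambda,\lambda_2}$ is optimal whenever $0\le\lambda_2<\lambda$, $E[\xi_TX_{\lambda,\lambda_2}]=x_0$ and $E[\xi_T(L-X_{\lambda,\lambda_2})\mathbf 1_{X_{\lambda,\lambda_2}<L}]=\epsilon$; such $\lambda,\lambda_2$ exist if $x_0>x_0^{min}$; if $x_0=x_0^{min}$, the wealth $L\mathbf 1_{\xi_T<U'(L-D_T)/\bar\lambda}+(I(\bar\lambda\xi_T)+D_T)\mathbf 1_{U'(L-D_T)/\bar\lambda\le\xi_T<U'(\hat D_T-D_T)/\bar\lambda}$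 (the limit as $\lambda\to\infty$, $\lambda-\lambda_2=\bar\lambda$) is optimal. ii) If $x_0\ge x_0^3$, there is a $\lambda>0$ with $E[\xi_TX^B_\lambda]=x_0$, and $X^B_\lambda$ is optimal for every such $\lambda$. -/

import Mathlib

open MeasureTheory Set Filter Topology

noncomputable section

namespace SurplusES

/-- Utility functions on `[0, ∞)` (values of `U` at negative arguments are never used):
`U 0 = 0`, continuous, strictly increasing, strictly concave, continuously differentiable on
`(0, ∞)`, with the Inada conditions and the asymptotic elasticity condition. -/
structure IsUtility (U : ℝ → ℝ) : Prop where
  zero : U 0 = 0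
  continuousOn : ContinuousOn U (Ici 0)
  strictMonoOn : StrictMonoOn U (Ici 0)
  strictConcaveOn : StrictConcaveOn ℝ (Ici 0) U
  differentiableOn : DifferentiableOn ℝ U (Ioi 0)
  continuousOn_deriv : ContinuousOn (deriv U) (Ioi 0)
  inada_zero : Tendsto (deriv U) (𝓝[>] 0) atTop
  inada_top : Tendsto (deriv U) atTop (𝓝 0)
  asymptotic_elasticity : limsup (fun x => x * deriv U x / U x) atTop < 1

/-- The inverse `I` of the marginal utility `U' : (0, ∞) → (0, ∞)`. -/
def inverseMarginal (U : ℝ → ℝ) : ℝ → ℝ :=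
  Function.invFunOn (deriv U) (Ioi 0)

/-- `dhat` is the tangent point with respect to `d`: the line through the origin and the point of
abscissa `dhat` on the graph of `x ↦ U (x - d)`, `x > d`, is tangent to this graph there. -/
def IsTangentPoint (U : ℝ → ℝ) (d dhat : ℝ) : Prop :=
  d < dhat ∧ U (dhat - d) / dhat = deriv U (dhat - d)

section Market

variable {Ω : Type*} [MeasurableSpace Ω]

/-- The state price density `ξ_T = (S_0(0) / S_0(T)) dQ/dP`, where the bank account grows at the
short rate `r`. -/
def statePriceDensity (P Q : Measure Ω) (r : ℝ → ℝ) (T : ℝ) (ω : Ω) : ℝ :=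
  Real.exp (-∫ s in (0 : ℝ)..T, r s) * (Q.rnDeriv P ω).toReal

/-- The price `E[ξ X]` at time `0` of the terminal payoff `X`. -/
def price (P : Measure Ω) (ξ X : Ω → ℝ) : ℝ :=
  ∫ ω, ξ ω * X ω ∂P

/-- The expected shortfall (limited expected loss) `E[ξ (L - X) 1_{X < L}]`. -/
def shortfall (P : Measure Ω) (ξ : Ω → ℝ) (L : ℝ) (X : Ω → ℝ) : ℝ :=
  ∫ ω, {ω | X ω < L}.indicator (fun ω => ξ ω * (L - X ω)) ω ∂P

/-- The expected utility `E[U((X - D)^+)]` of the surplus, an expectation of a nonnegative random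
variable. -/
def expectedUtility (P : Measure Ω) (U : ℝ → ℝ) (D : ℝ) (X : Ω → ℝ) : ENNReal :=
  ∫⁻ ω, ENNReal.ofReal (U (max (X ω - D) 0)) ∂P

/-- The attainable terminal wealths from the initial capital `x₀`. The σ-algebra of `Ω` is the
information at the horizon; the market is complete, so every nonnegative payoff which is measurable
for it and has price `x₀` is replicable. -/
structure IsAttainable (P : Measure Ω) (ξ : Ω → ℝ) (x₀ : ℝ) (X : Ω → ℝ) : Prop where
  measurable : Measurable X
  nonneg : ∀ᵐ ω ∂P, 0 ≤ X ω
  integrable : Integrable (fun ω => ξ ω * X ω) P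
  price_eq : price P ξ X = x₀

/-- The constraints of the ES-constrained problem. -/
structure IsFeasible (P : Measure Ω) (ξ : Ω → ℝ) (L ε x₀ : ℝ) (X : Ω → ℝ) : Prop where
  attainable : IsAttainable P ξ x₀ X
  shortfall_le : shortfall P ξ L X ≤ ε
  budget : price P ξ X ≤ x₀

/-- `X` solves the ES-constrained problem, with a finite optimal value. -/
structure IsOptimal (P : Measure Ω) (ξ : Ω → ℝ) (U : ℝ → ℝ) (D L ε x₀ : ℝ) (X : Ω → ℝ) :
    Prop where
  feasible : IsFeasible P ξ L ε x₀ X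
  finite : expectedUtility P U D X < ⊤
  maximal : ∀ Y : Ω → ℝ, IsFeasible P ξ L ε x₀ Y →
    expectedUtility P U D Y ≤ expectedUtility P U D X

/-- `ξbar` satisfies `E[L ξ 1_{ξ ≥ ξbar}] = ε`. -/
def IsDefaultThreshold (P : Measure Ω) (ξ : Ω → ℝ) (L ε ξbar : ℝ) : Prop :=
  0 < ξbar ∧ ∫ ω, {ω | ξbar ≤ ξ ω}.indicator (fun ω => L * ξ ω) ω ∂P = ε

/-- `lbar > 0` satisfies `E[ξ (L - I(lbar ξ) - D) 1_{U'(Dhat - D) > ξ lbar ≥ U'(L - D)}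
+ ξ L 1_{ξ lbar ≥ U'(Dhat - D)}] = ε`. -/
def IsCriticalMultiplier (P : Measure Ω) (ξ : Ω → ℝ) (U : ℝ → ℝ) (D Dhat L ε lbar : ℝ) : Prop :=
  0 < lbar ∧
  ∫ ω, ({ω | ξ ω * lbar < deriv U (Dhat - D) ∧ deriv U (L - D) ≤ ξ ω * lbar}.indicator
        (fun ω => ξ ω * (L - inverseMarginal U (lbar * ξ ω) - D)) ω
      + {ω | deriv U (Dhat - D) ≤ ξ ω * lbar}.indicator (fun ω => ξ ω * L) ω) ∂P = ε

end Market

/-! Candidate terminal wealths, as functions of the value `x` of the state price density. -/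

/-- `(I(lam x) + D) 1_{x < b}`. -/
def twoRegion (U : ℝ → ℝ) (D b lam x : ℝ) : ℝ :=
  (Iio b).indicator (fun x => inverseMarginal U (lam * x) + D) x

/-- `(I(lam x) + D) 1_{x < a} + L 1_{a ≤ x < b}`. -/
def threeRegion (U : ℝ → ℝ) (D L a b lam x : ℝ) : ℝ :=
  (Iio a).indicator (fun x => inverseMarginal U (lam * x) + D) x + (Ico a b).indicator (fun _ => L) x

/-- The benchmark wealth `(I(lam x) + D) 1_{x < U'(Dhat - D) / lam}`. -/
def benchmark (U : ℝ → ℝ) (D Dhat lam x : ℝ) : ℝ :=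
  twoRegion U D (deriv U (Dhat - D) / lam) lam x

open Classical in
/-- The solution for `L ≤ D` when the constraint binds. The critical state price is
`a = U'(Ltilde - (D - L)) / lam`, read as `∞` when `L = D`; the solution has two regions if
`ξbar ≤ a` and three regions if `a < ξbar`. -/
def wealthLow (U : ℝ → ℝ) (D L Ltilde ξbar lam x : ℝ) : ℝ :=
  if L = D ∨ ξbar ≤ deriv U (Ltilde - (D - L)) / lam then twoRegion U D ξbar lam x
  else threeRegion U D L (deriv U (Ltilde - (D - L)) / lam) ξbar lam x

open Classical in
/-- The solution for `D < L ≤ Dhat` when the constraint binds. With `a = U'(L - D) / lam`, it has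
two regions if `ξbar < a` and three regions if `a ≤ ξbar`. -/
def wealthMid (U : ℝ → ℝ) (D L ξbar lam x : ℝ) : ℝ :=
  if ξbar < deriv U (L - D) / lam then twoRegion U D ξbar lam x
  else threeRegion U D L (deriv U (L - D) / lam) ξbar lam x

/-- The four-region solution for `Dhat < L` when the constraint binds:
`(I(lam x) + D) 1_{x < a} + L 1_{a ≤ x < b} + (I((lam - lam₂) x) + D) 1_{b ≤ x < c}`. -/
def wealthHigh (U : ℝ → ℝ) (D Dhat L lam lam₂ x : ℝ) : ℝ :=
  (Iio (deriv U (L - D) / lam)).indicator (fun x => inverseMarginal U (lam * x) + D) x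
  + (Ico (deriv U (L - D) / lam) (deriv U (L - D) / (lam - lam₂))).indicator (fun _ => L) x
  + (Ico (deriv U (L - D) / (lam - lam₂)) (deriv U (Dhat - D) / (lam - lam₂))).indicator
      (fun x => inverseMarginal U ((lam - lam₂) * x) + D) x

/-- The limit `L 1_{x < ξbar}` of `wealthLow` and `wealthMid` as `lam → ∞`. -/
def wealthLimit (L ξbar x : ℝ) : ℝ :=
  (Iio ξbar).indicator (fun _ => L) x

/-- The limit of `wealthHigh` as `lam → ∞` with `lam - lam₂ = lbar` fixed. -/
def wealthHighLimit (U : ℝ → ℝ) (D Dhat L lbar x : ℝ) : ℝ :=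
  (Iio (deriv U (L - D) / lbar)).indicator (fun _ => L) x
  + (Ico (deriv U (L - D) / lbar) (deriv U (Dhat - D) / lbar)).indicator
      (fun x => inverseMarginal U (lbar * x) + D) x

end SurplusES

end

open SurplusES

/-! The proof is Lagrangian duality carried out state by state. With p = λξ and q = λ₂ξ, consider
the function w ↦ U((w - D)^+) - p w - q (L - w)^+ of the wealth w in one state. If a candidate
maximizes it in almost every state, integrating the inequality against any feasible competitor gives
optimality: the price terms cancel because both wealths cost x₀, and the shortfall terms have the
right sign when λ₂ = 0 or the shortfall constraint binds (`isOptimal_of_lagrangian`). No duality gap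
arises from the non-concavity of the surplus utility, since the maximization is pointwise.

The pointwise problem is governed by tangents from the origin. The best surplus is I(p) + D, worth
conjugate(p) - pD, and it beats default without penalty exactly up to the slope at the tangent point
(`mul_le_conjugate`, `conjugate_le_mul`). For L ≤ Dhat the candidates default exactly on ξ ≥ ξbar
and are at least L elsewhere, so their shortfall is ε for every λ. It remains to find λ₂ ≥ 0 that
makes default and the best alternative equally good at ξ = ξbar; for L < D, once the L-region is
present, λ₂ = λ works because 0 and L are then indifferent in every state. For L > Dhat the
Lagrangian has a kink at L: wealth costs p - q below L and p above it. The shortfall depends on λ -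
λ₂ alone, so fixing this difference at `lbar` makes the constraint bind and leaves λ free for the
budget.

Multipliers are found by the intermediate value theorem. Prices are continuous in λ by dominated
convergence, because ξ has no atoms and the moving thresholds are null; they run from the benchmark
price at the critical multiplier down to the minimal capital as λ → ∞. At the minimal capital
itself, feasibility forces Y ≤ L almost surely (`IsFeasible.le_level`), so it suffices to maximize
the unpenalized Lagrangian over w ≤ L. Above the critical capital, strict monotonicity of the
benchmark price bounds λ, the shortfall is at most ε, and λ₂ = 0 works. -/

namespace SurplusES

/-! ### Utility, inverse marginal utility and Fenchel inequality -/

namespace IsUtility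

variable {U : ℝ → ℝ}

lemma le_tangent (hU : IsUtility U) {a x : ℝ} (ha : 0 < a) (hx : 0 ≤ x) :
    U x ≤ U a + deriv U a * (x - a) := by
  have hd : DifferentiableAt ℝ U a := hU.differentiableOn.differentiableAt (Ioi_mem_nhds ha)
  rcases lt_trichotomy x a with h | h | h
  · have := hU.strictConcaveOn.concaveOn.deriv_le_slope (show x ∈ Ici (0 : ℝ) from hx)
      (show a ∈ Ici (0 : ℝ) from ha.le) h hd
    rw [slope_def_field, le_div_iff₀ (by linarith)] at this
    linarith
  · simp [h]
  · have := hU.strictConcaveOn.concaveOn.slope_le_deriv (show a ∈ Ici (0 : ℝ) from ha.le)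
      (show x ∈ Ici (0 : ℝ) from hx) h hd
    rw [slope_def_field, div_le_iff₀ (by linarith)] at this
    linarith

lemma deriv_pos (hU : IsUtility U) {a : ℝ} (ha : 0 < a) : 0 < deriv U a := by
  have h1 := hU.le_tangent ha (show 0 ≤ a + 1 by linarith)
  have h2 := hU.strictMonoOn (show a ∈ Ici (0 : ℝ) from ha.le)
    (show a + 1 ∈ Ici (0 : ℝ) by simp; linarith) (by linarith)
  linarith

lemma deriv_strictAntiOn (hU : IsUtility U) : StrictAntiOn (deriv U) (Ioi 0) := by
  refine (hU.strictConcaveOn.subset Ioi_subset_Ici_self (convex_Ioi 0)).strictAntiOn_deriv ?_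
  exact fun x hx => hU.differentiableOn.differentiableAt (Ioi_mem_nhds hx)

lemma nonneg (hU : IsUtility U) {x : ℝ} (hx : 0 ≤ x) : 0 ≤ U x := by
  have := hU.strictMonoOn.monotoneOn (show (0 : ℝ) ∈ Ici (0 : ℝ) by simp)
    (show x ∈ Ici (0 : ℝ) from hx) hx
  rwa [hU.zero] at this

lemma mono (hU : IsUtility U) {x y : ℝ} (hx : 0 ≤ x) (hxy : x ≤ y) : U x ≤ U y :=
  hU.strictMonoOn.monotoneOn (show x ∈ Ici (0 : ℝ) from hx)
    (show y ∈ Ici (0 : ℝ) from hx.trans hxy) hxy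

lemma exists_deriv_eq (hU : IsUtility U) {y : ℝ} (hy : 0 < y) : ∃ x ∈ Ioi (0 : ℝ), deriv U x = y := by
  have := isPreconnected_Ioi.intermediate_value_Ioi (s := Ioi (0 : ℝ)) (l₁ := atTop)
    (l₂ := 𝓝[>] (0 : ℝ)) (by simpa using Ioi_mem_atTop (0 : ℝ)) inf_le_right
    hU.continuousOn_deriv hU.inada_top hU.inada_zero
  exact this hy

lemma inverseMarginal_pos (hU : IsUtility U) {y : ℝ} (hy : 0 < y) : 0 < inverseMarginal U y :=
  Function.invFunOn_mem (hU.exists_deriv_eq hy)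

lemma deriv_inverseMarginal (hU : IsUtility U) {y : ℝ} (hy : 0 < y) :
    deriv U (inverseMarginal U y) = y :=
  Function.invFunOn_eq (hU.exists_deriv_eq hy)

lemma inverseMarginal_deriv (hU : IsUtility U) {x : ℝ} (hx : 0 < x) :
    inverseMarginal U (deriv U x) = x :=
  hU.deriv_strictAntiOn.injOn (hU.inverseMarginal_pos (hU.deriv_pos hx)) hx
    (hU.deriv_inverseMarginal (hU.deriv_pos hx))

lemma inverseMarginal_strictAntiOn (hU : IsUtility U) :
    StrictAntiOn (inverseMarginal U) (Ioi 0) := by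
  intro x hx y hy hxy
  rw [← hU.deriv_strictAntiOn.lt_iff_gt (hU.inverseMarginal_pos hx) (hU.inverseMarginal_pos hy),
    hU.deriv_inverseMarginal hx, hU.deriv_inverseMarginal hy]
  exact hxy

lemma inverseMarginal_le (hU : IsUtility U) {x y : ℝ} (hx : 0 < x) (hxy : x ≤ y) :
    inverseMarginal U y ≤ inverseMarginal U x :=
  hU.inverseMarginal_strictAntiOn.antitoneOn hx (hx.trans_le hxy) hxy

lemma le_inverseMarginal_iff (hU : IsUtility U) {x y : ℝ} (hx : 0 < x) (hy : 0 < y) :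
    x ≤ inverseMarginal U y ↔ y ≤ deriv U x := by
  rw [← hU.deriv_strictAntiOn.le_iff_ge (hU.inverseMarginal_pos hy) hx, hU.deriv_inverseMarginal hy]

lemma inverseMarginal_le_iff (hU : IsUtility U) {x y : ℝ} (hx : 0 < x) (hy : 0 < y) :
    inverseMarginal U y ≤ x ↔ deriv U x ≤ y := by
  rw [← hU.deriv_strictAntiOn.le_iff_ge hx (hU.inverseMarginal_pos hy), hU.deriv_inverseMarginal hy]

lemma inverseMarginal_image (hU : IsUtility U) : inverseMarginal U '' Ioi 0 = Ioi 0 := by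
  ext x
  constructor
  · rintro ⟨y, hy, rfl⟩
    exact hU.inverseMarginal_pos hy
  · exact fun hx => ⟨_, hU.deriv_pos hx, hU.inverseMarginal_deriv hx⟩

/-- A strictly monotone function whose image is a neighbourhood of the value is continuous there;
the sign change turns the decreasing `I` into an increasing function. -/
lemma continuousAt_inverseMarginal (hU : IsUtility U) {y : ℝ} (hy : 0 < y) :
    ContinuousAt (inverseMarginal U) y := by
  have h := StrictMonoOn.continuousAt_of_image_mem_nhds (f := fun y => -inverseMarginal U y)
    (s := Ioi 0) (a := y) (fun a ha b hb hab => neg_lt_neg (hU.inverseMarginal_strictAntiOn ha hb hab))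
    (Ioi_mem_nhds hy) (by
      have : (fun y => -inverseMarginal U y) '' Ioi 0 = Iio 0 := by
        rw [← image_image (fun x => -x), hU.inverseMarginal_image]
        simp
      rw [this]
      exact Iio_mem_nhds (neg_neg_of_pos (hU.inverseMarginal_pos hy)))
  have h' : ContinuousAt (fun y => - -inverseMarginal U y) y := h.neg
  simpa only [neg_neg] using h'

lemma measurable_inverseMarginal (hU : IsUtility U) : Measurable (inverseMarginal U) := by
  -- A number y ≤ 0 is not a value of U', so `invFunOn` returns its default there, which does not
  -- depend on y.
  have hc : ∀ y ∈ Iic (0 : ℝ), inverseMarginal U y = inverseMarginal U 0 := by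
    have key : ∀ y : ℝ, y ≤ 0 → ¬ ∃ a ∈ Ioi (0 : ℝ), deriv U a = y := by
      rintro y hy ⟨a, ha, rfl⟩
      exact absurd (hU.deriv_pos ha) (not_lt.2 hy)
    intro y hy
    unfold inverseMarginal Function.invFunOn
    rw [dif_neg (key y hy), dif_neg (key 0 le_rfl)]
  refine measurable_of_restrict_of_restrict_compl (s := Ioi (0 : ℝ)) measurableSet_Ioi ?_ ?_
  · refine Continuous.measurable ?_
    rw [← continuousOn_iff_continuous_domRestrict]
    exact fun y hy => (hU.continuousAt_inverseMarginal hy).continuousWithinAt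
  · have : (Ioi (0 : ℝ))ᶜ.domRestrict (inverseMarginal U) = fun _ => inverseMarginal U 0 := by
      funext y
      exact hc y (by simpa using y.2)
    rw [this]
    exact measurable_const

lemma tendsto_inverseMarginal_atTop (hU : IsUtility U) :
    Tendsto (inverseMarginal U) atTop (𝓝 0) := by
  refine tendsto_order.2 ⟨fun a ha => ?_, fun a ha => ?_⟩
  · filter_upwards [Ioi_mem_atTop 0] with y hy
    exact ha.trans (hU.inverseMarginal_pos hy)
  · filter_upwards [Ioi_mem_atTop (deriv U a)] with y hy
    have := hU.inverseMarginal_strictAntiOn (hU.deriv_pos ha) ((hU.deriv_pos ha).trans hy) hy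
    rwa [hU.inverseMarginal_deriv ha] at this

/-- The Fenchel inequality. -/
lemma sub_mul_le (hU : IsUtility U) {x y : ℝ} (hx : 0 ≤ x) (hy : 0 < y) :
    U x - y * x ≤ U (inverseMarginal U y) - y * inverseMarginal U y := by
  have := hU.le_tangent (hU.inverseMarginal_pos hy) hx
  rw [hU.deriv_inverseMarginal hy] at this
  linarith

lemma conjugate_nonneg (hU : IsUtility U) {y : ℝ} (hy : 0 < y) :
    0 ≤ U (inverseMarginal U y) - y * inverseMarginal U y := by
  simpa [hU.zero] using hU.sub_mul_le le_rfl hy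

lemma conjugate_le (hU : IsUtility U) {y z : ℝ} (hy : 0 < y) (hyz : y ≤ z) :
    U (inverseMarginal U z) - z * inverseMarginal U z ≤
      U (inverseMarginal U y) - y * inverseMarginal U y := by
  have hz := hU.inverseMarginal_pos (hy.trans_le hyz)
  have := hU.sub_mul_le hz.le hy
  nlinarith

/-- With x = t - d, tangency means that U x - (x + d) U' x vanishes. This function is strictly
increasing on x > 0, nonpositive somewhere near 0 since U' blows up, and nonnegative far out since U
x - x U' x stays above its positive value at 1 while d U' x tends to 0. -/
lemma existsUnique_isTangentPoint (hU : IsUtility U) {d : ℝ} (hd : 0 < d) :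
    ∃! t, IsTangentPoint U d t := by
  have hanti : StrictMonoOn (fun x => U x - (x + d) * deriv U x) (Ioi 0) := by
    intro x hx y hy hxy
    have h1 := hU.le_tangent hy (le_of_lt hx)
    have h2 := hU.deriv_strictAntiOn hx hy hxy
    have h3 : 0 < (x + d) * (deriv U x - deriv U y) :=
      mul_pos (add_pos hx hd) (sub_pos.2 h2)
    show U x - (x + d) * deriv U x < U y - (y + d) * deriv U y
    nlinarith
  have hcont : ContinuousOn (fun x => U x - (x + d) * deriv U x) (Ioi 0) :=
    (hU.continuousOn.mono Ioi_subset_Ici_self).sub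
      ((continuousOn_id.add continuousOn_const).mul hU.continuousOn_deriv)
  have hneg : ∃ x ∈ Ioi (0 : ℝ), U x - (x + d) * deriv U x ≤ 0 := by
    have := (hU.inada_zero.eventually (eventually_ge_atTop (U 1 / d))).and
      (Ioc_mem_nhdsGT (zero_lt_one (α := ℝ)))
    obtain ⟨x, hx, hx0, hx1⟩ := this.exists
    refine ⟨x, hx0, ?_⟩
    have h1 := hU.mono hx0.le hx1
    rw [div_le_iff₀ hd] at hx
    nlinarith [hU.deriv_pos hx0]
  have hpos : ∃ x ∈ Ioi (0 : ℝ), 0 ≤ U x - (x + d) * deriv U x := by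
    -- Passing through the intermediate point 1/2 makes the tangent inequality between 0 and 1
    -- strict.
    have hc : 0 < U 1 - deriv U 1 := by
      have h1 := hU.le_tangent (show (0 : ℝ) < 1 / 2 by norm_num) le_rfl
      have h2 := hU.le_tangent one_pos (show (0 : ℝ) ≤ 1 / 2 by norm_num)
      have h3 := hU.deriv_strictAntiOn (show (1 / 2 : ℝ) ∈ Ioi 0 by norm_num)
        (show (1 : ℝ) ∈ Ioi 0 by norm_num) (by norm_num)
      rw [hU.zero] at h1
      linarith
    have := (hU.inada_top.eventually (eventually_lt_nhds (div_pos hc hd))).and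
      (eventually_ge_atTop 1)
    obtain ⟨x, hx, hx1⟩ := this.exists
    have hx0 : (0 : ℝ) < x := by linarith
    refine ⟨x, hx0, ?_⟩
    have h1 := hU.le_tangent hx0 (zero_le_one)
    have h2 := hU.deriv_strictAntiOn.antitoneOn (show (1 : ℝ) ∈ Ioi 0 by norm_num) hx0 hx1
    rw [lt_div_iff₀ hd] at hx
    nlinarith
  obtain ⟨a, ha, ha'⟩ := hneg
  obtain ⟨b, hb, hb'⟩ := hpos
  obtain ⟨x, hx, hx'⟩ := isPreconnected_Ioi.intermediate_value ha hb hcont ⟨ha', hb'⟩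
  have hx0 : (0 : ℝ) < x := hx
  refine ⟨x + d, ⟨by linarith, ?_⟩, ?_⟩
  · rw [add_sub_cancel_right, div_eq_iff (by positivity)]
    simp only at hx'
    linarith
  · rintro t ⟨ht, ht'⟩
    rw [div_eq_iff (by linarith)] at ht'
    have := hanti.injOn (show t - d ∈ Ioi (0 : ℝ) by simpa using ht) hx (by
      simp only at hx' ⊢
      rw [hx', sub_add_cancel]
      linarith)
    linarith

end IsUtility

/-! ### Tangents from the origin to the surplus utility -/

section Tangent

variable {U : ℝ → ℝ} {d t : ℝ}

lemma IsTangentPoint.eq (h : IsTangentPoint U d t) (hd : 0 < d) :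
    U (t - d) = deriv U (t - d) * t := by
  have := h.2
  rwa [div_eq_iff (by linarith [h.1])] at this

lemma IsTangentPoint.slope_pos (h : IsTangentPoint U d t) (hU : IsUtility U) :
    0 < deriv U (t - d) :=
  hU.deriv_pos (sub_pos.2 h.1)

/-- The tangent through the origin dominates the utility of the surplus. -/
lemma IsTangentPoint.le_line (h : IsTangentPoint U d t) (hU : IsUtility U) (hd : 0 < d) {x : ℝ}
    (hx : 0 ≤ x) : U x ≤ deriv U (t - d) * (x + d) := by
  have := hU.le_tangent (sub_pos.2 h.1) hx
  rw [h.eq hd] at this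
  linarith

/-- The conjugate is tested at x = t - d. Together with `conjugate_le_mul`, which uses the tangent
as an upper bound, this makes the slope at t the critical price: below it a surplus is worth at
least 0 net of the cost y d, above it at most 0. -/
lemma IsTangentPoint.mul_le_conjugate (h : IsTangentPoint U d t) (hU : IsUtility U) (hd : 0 < d)
    {y : ℝ} (hy : 0 < y) (hyk : y ≤ deriv U (t - d)) :
    y * d ≤ U (inverseMarginal U y) - y * inverseMarginal U y := by
  have h1 := hU.sub_mul_le (sub_pos.2 h.1).le hy
  rw [h.eq hd] at h1
  nlinarith [h.1]

lemma IsTangentPoint.conjugate_le_mul (h : IsTangentPoint U d t) (hU : IsUtility U) (hd : 0 < d)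
    {y : ℝ} (hyk : deriv U (t - d) ≤ y) :
    U (inverseMarginal U y) - y * inverseMarginal U y ≤ y * d := by
  have hI := hU.inverseMarginal_pos ((h.slope_pos hU).trans_le hyk)
  have h1 := h.le_line hU hd hI.le
  nlinarith

/-- If the slope for the smaller shift d' were smaller, at that price y the conjugate would be at
least y d and at most y d', contradicting d' < d. -/
lemma IsTangentPoint.slope_le (h : IsTangentPoint U d t) (hU : IsUtility U) (hd : 0 < d)
    {d' t' : ℝ} (h' : IsTangentPoint U d' t') (hd' : 0 < d') (hdd : d' < d) :
    deriv U (t - d) ≤ deriv U (t' - d') := by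
  by_contra! hlt
  have h1 := h.mul_le_conjugate hU hd (h'.slope_pos hU) hlt.le
  have h2 := h'.conjugate_le_mul hU hd' le_rfl
  nlinarith [h'.slope_pos hU]

/-- Below the tangent point the average utility of the surplus increases. -/
lemma IsTangentPoint.mul_le_mul_of_le (h : IsTangentPoint U d t) (hU : IsUtility U) (hd : 0 < d)
    {x y : ℝ} (hx : 0 ≤ x) (hxy : x ≤ y) (hy : 0 < y) (hyt : y ≤ t - d) :
    U x * (y + d) ≤ U y * (x + d) := by
  have h1 := hU.le_tangent hy hx
  have h2 := hU.deriv_strictAntiOn.antitoneOn (show y ∈ Ioi (0 : ℝ) from hy)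
    (show t - d ∈ Ioi (0 : ℝ) from sub_pos.2 h.1) hyt
  have h3 := h.le_line hU hd hy.le
  have h4 : U x - deriv U (t - d) * (x + d) ≤ U y - deriv U (t - d) * (y + d) := by nlinarith
  nlinarith

end Tangent

end SurplusES

/-! ### The pointwise Lagrangian and its upper bounds -/

namespace SurplusES

/-- The pointwise Lagrangian of the ES-constrained problem, with multiplier `p` for the budget and
`q` for the shortfall constraint (both multiplied by the state price). -/
noncomputable def lagrangian (U : ℝ → ℝ) (D L p q w : ℝ) : ℝ :=
  U (max (w - D) 0) - p * w - q * max (L - w) 0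

/-- The convex conjugate `sup_x (U x - y x)` of the utility. -/
noncomputable def conjugate (U : ℝ → ℝ) (y : ℝ) : ℝ :=
  U (inverseMarginal U y) - y * inverseMarginal U y

section Lagrangian

variable {U : ℝ → ℝ} {D L p q w : ℝ}

lemma lagrangian_of_le_of_le (hU : IsUtility U) (hD : w ≤ D) (hL : w ≤ L) :
    lagrangian U D L p q w = -(p * w) - q * (L - w) := by
  rw [lagrangian, max_eq_right (by linarith), max_eq_left (by linarith), hU.zero]
  ring

lemma lagrangian_of_le_of_ge (hU : IsUtility U) (hD : w ≤ D) (hL : L ≤ w) :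
    lagrangian U D L p q w = -(p * w) := by
  rw [lagrangian, max_eq_right (by linarith), max_eq_right (by linarith), hU.zero]
  ring

lemma lagrangian_of_ge_of_le (hD : D ≤ w) (hL : w ≤ L) :
    lagrangian U D L p q w = U (w - D) - p * w - q * (L - w) := by
  rw [lagrangian, max_eq_left (by linarith), max_eq_left (by linarith)]

lemma lagrangian_of_ge_of_ge (hD : D ≤ w) (hL : L ≤ w) :
    lagrangian U D L p q w = U (w - D) - p * w := by
  rw [lagrangian, max_eq_left (by linarith), max_eq_right (by linarith)]
  ring

lemma lagrangian_zero (hU : IsUtility U) (hD : 0 ≤ D) (hL : 0 ≤ L) :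
    lagrangian U D L p q 0 = -(q * L) := by
  rw [lagrangian_of_le_of_le hU hD hL]
  ring

lemma lagrangian_inverseMarginal_of_ge (hU : IsUtility U) (hp : 0 < p)
    (hL : L ≤ inverseMarginal U p + D) :
    lagrangian U D L p q (inverseMarginal U p + D) = conjugate U p - p * D := by
  rw [lagrangian_of_ge_of_ge (by linarith [hU.inverseMarginal_pos hp]) hL, conjugate,
    add_sub_cancel_right]
  ring

lemma IsUtility.sub_mul_le_conjugate (hU : IsUtility U) (hp : 0 < p) (hw : D ≤ w) :
    U (w - D) - p * w ≤ conjugate U p - p * D := by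
  have := hU.sub_mul_le (sub_nonneg.2 hw) hp
  rw [conjugate]
  linarith

lemma IsUtility.le_tangent_of_le (hU : IsUtility U) (hDL : D < L) (hw : D ≤ w) :
    U (w - D) ≤ U (L - D) + deriv U (L - D) * (w - L) := by
  have := hU.le_tangent (sub_pos.2 hDL) (sub_nonneg.2 hw)
  rwa [sub_sub_sub_cancel_right] at this

/-- Up to D there is no surplus, and for q ≤ p the Lagrangian decreases: its slope is q - p up to L
and -p afterwards. So default is best there; above D the Fenchel inequality applies. -/
lemma lagrangian_le_of_le (hU : IsUtility U) (hL : 0 < L) (hLD : L ≤ D) (hp : 0 < p)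
    (hqp : q ≤ p) (hw : 0 ≤ w) :
    lagrangian U D L p q w ≤ max (-(q * L)) (conjugate U p - p * D) := by
  rcases le_total w D with hwD | hwD
  · refine le_max_of_le_left ?_
    rcases le_total w L with hwL | hwL
    · rw [lagrangian_of_le_of_le hU hwD hwL]
      nlinarith
    · rw [lagrangian_of_le_of_ge hU hwD hwL]
      nlinarith
  · refine le_max_of_le_right ?_
    rw [lagrangian_of_ge_of_ge hwD (hLD.trans hwD)]
    exact hU.sub_mul_le_conjugate hp hwD

variable {t : ℝ}

/-- Up to the tangent point, the chord from the origin to the graph at L lies above the surplus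
utility. -/
lemma IsTangentPoint.mul_le_mul (ht : IsTangentPoint U D t) (hU : IsUtility U) (hD : 0 < D)
    (hDL : D < L) (hLt : L ≤ t) (hw : 0 ≤ w) (hwL : w ≤ L) :
    U (max (w - D) 0) * L ≤ U (L - D) * w := by
  rcases le_total w D with hwD | hwD
  · rw [max_eq_right (by linarith), hU.zero, zero_mul]
    exact mul_nonneg (hU.nonneg (sub_pos.2 hDL).le) hw
  · rw [max_eq_left (by linarith)]
    have := ht.mul_le_mul_of_le hU hD (sub_nonneg.2 hwD) (y := L - D) (by linarith) (by linarith)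
      (by linarith)
    simpa using this

/-- Once the utility is replaced by its chord, the Lagrangian is affine on [0, L], hence bounded by
its values at the two ends. -/
lemma lagrangian_le_of_mid_of_le (ht : IsTangentPoint U D t) (hU : IsUtility U) (hD : 0 < D)
    (hDL : D < L) (hLt : L ≤ t) (hw : 0 ≤ w) (hwL : w ≤ L) :
    lagrangian U D L p q w ≤ max (-(q * L)) (U (L - D) - p * L) := by
  have hL : 0 < L := hD.trans hDL
  have h := ht.mul_le_mul hU hD hDL hLt hw hwL
  rw [lagrangian, max_eq_left (b := (0 : ℝ)) (sub_nonneg.2 hwL)]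
  set M := max (-(q * L)) (U (L - D) - p * L)
  have h1 : -(q * L) ≤ M := le_max_left _ _
  have h2 : U (L - D) - p * L ≤ M := le_max_right _ _
  have h3 := mul_le_mul_of_nonneg_left h1 (sub_nonneg.2 hwL)
  have h4 := mul_le_mul_of_nonneg_left h2 hw
  refine le_of_mul_le_mul_right ?_ hL
  linarith

lemma lagrangian_le_of_mid (ht : IsTangentPoint U D t) (hU : IsUtility U) (hD : 0 < D)
    (hDL : D < L) (hLt : L ≤ t) (hp : 0 < p) (hw : 0 ≤ w) :
    lagrangian U D L p q w ≤ max (-(q * L)) (conjugate U p - p * D) := by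
  rcases le_total w L with hwL | hwL
  · exact (lagrangian_le_of_mid_of_le ht hU hD hDL hLt hw hwL).trans
      (max_le_max le_rfl (hU.sub_mul_le_conjugate hp hDL.le))
  · rw [lagrangian_of_ge_of_ge (hDL.le.trans hwL) hwL]
    exact le_max_of_le_right (hU.sub_mul_le_conjugate hp (hDL.le.trans hwL))

lemma lagrangian_le_of_mid_of_deriv_le (ht : IsTangentPoint U D t) (hU : IsUtility U) (hD : 0 < D)
    (hDL : D < L) (hLt : L ≤ t) (hp : deriv U (L - D) ≤ p) (hw : 0 ≤ w) :
    lagrangian U D L p q w ≤ max (-(q * L)) (U (L - D) - p * L) := by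
  rcases le_total w L with hwL | hwL
  · exact lagrangian_le_of_mid_of_le ht hU hD hDL hLt hw hwL
  · rw [lagrangian_of_ge_of_ge (hDL.le.trans hwL) hwL]
    have := hU.le_tangent_of_le hDL (hDL.le.trans hwL)
    refine le_max_of_le_right ?_
    nlinarith

end Lagrangian

/-! ### The candidate wealths maximize the Lagrangian in every state -/

section Profiles

variable {U : ℝ → ℝ} {D L t ξbar lam lam₂ s w : ℝ}

/-- The two-region wealth maximizes the Lagrangian whose shortfall multiplier makes default and
surplus equally good in the state `ξbar`. -/
lemma lagrangian_le_twoRegion (hU : IsUtility U) (hD : 0 < D) (hL : 0 < L)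
    (hlam : 0 < lam)
    (hmax : ∀ s w, 0 < s → 0 ≤ w → lagrangian U D L (lam * s) (lam₂ * s) w ≤
      max (-(lam₂ * s * L)) (conjugate U (lam * s) - lam * s * D))
    (hge : ∀ s, 0 < s → s < ξbar → L ≤ inverseMarginal U (lam * s) + D)
    (heq : lam₂ * ξbar * L = lam * ξbar * D - conjugate U (lam * ξbar)) (hξbar : 0 < ξbar)
    (hs : 0 < s) (hw : 0 ≤ w) :
    lagrangian U D L (lam * s) (lam₂ * s) w ≤
      lagrangian U D L (lam * s) (lam₂ * s) (twoRegion U D ξbar lam s) := by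
  refine (hmax s w hs hw).trans ?_
  have hp : 0 < lam * s := mul_pos hlam hs
  have hpb : 0 < lam * ξbar := mul_pos hlam hξbar
  rcases lt_or_ge s ξbar with hlt | hge'
  · rw [twoRegion, indicator_of_mem (show s ∈ Iio ξbar from hlt),
      lagrangian_inverseMarginal_of_ge hU hp (hge s hs hlt)]
    refine max_le ?_ le_rfl
    have h1 : conjugate U (lam * ξbar) ≤ conjugate U (lam * s) :=
      hU.conjugate_le hp (by gcongr)
    have h0 : 0 ≤ conjugate U (lam * ξbar) := hU.conjugate_nonneg hpb
    -- Multiplied by ξbar and simplified by `heq`, the claim becomes s · conjugate(λ ξbar) ≤ ξbar ·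
    -- conjugate(λ s), which holds because the conjugate is nonnegative and decreasing.
    refine le_of_mul_le_mul_right ?_ hξbar
    nlinarith
  · rw [twoRegion, indicator_of_notMem (by simpa using hge'), lagrangian_zero hU hD.le hL.le]
    refine max_le le_rfl ?_
    have h1 : conjugate U (lam * s) ≤ conjugate U (lam * ξbar) :=
      hU.conjugate_le hpb (by gcongr)
    have h0 : 0 ≤ conjugate U (lam * s) := hU.conjugate_nonneg hp
    refine le_of_mul_le_mul_right ?_ hξbar
    nlinarith

/-- With equal multipliers the Lagrangian is constant on [0, L], so 0 and L are indifferent and ξbar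
may be placed freely between them. A surplus competes with this constant, i.e. the conjugate with λ
s (D - L), which is why the tangent point for D - L decides. -/
lemma lagrangian_le_threeRegion_low (hU : IsUtility U) (hL : 0 < L) (hLD : L < D)
    (ht : IsTangentPoint U (D - L) t) (hlam : 0 < lam)
    (hs : 0 < s) (hw : 0 ≤ w) :
    lagrangian U D L (lam * s) (lam * s) w ≤ lagrangian U D L (lam * s) (lam * s)
      (threeRegion U D L (deriv U (t - (D - L)) / lam) ξbar lam s) := by
  have hp : 0 < lam * s := mul_pos hlam hs
  refine (lagrangian_le_of_le hU hL hLD.le hp le_rfl hw).trans ?_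
  have hd : 0 < D - L := sub_pos.2 hLD
  rcases lt_or_ge s (deriv U (t - (D - L)) / lam) with h | h
  · rw [threeRegion, indicator_of_mem (show s ∈ Iio _ from h),
      indicator_of_notMem (fun h' => absurd h (not_lt.2 h'.1)), add_zero,
      lagrangian_inverseMarginal_of_ge hU hp (by linarith [hU.inverseMarginal_pos hp])]
    refine max_le ?_ le_rfl
    rw [lt_div_iff₀ hlam, mul_comm] at h
    have := ht.mul_le_conjugate hU hd hp h.le
    rw [conjugate]
    linarith
  · have hle : conjugate U (lam * s) - lam * s * D ≤ -(lam * s * L) := by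
      rw [div_le_iff₀ hlam, mul_comm] at h
      have := ht.conjugate_le_mul hU hd h
      rw [conjugate]
      linarith
    rw [threeRegion, indicator_of_notMem (show s ∉ Iio _ from not_lt.2 h), zero_add]
    refine (max_le le_rfl hle).trans (le_of_eq ?_)
    rcases lt_or_ge s ξbar with h' | h'
    · rw [indicator_of_mem (show s ∈ Ico _ _ from ⟨h, h'⟩), lagrangian_of_le_of_ge hU hLD.le le_rfl]
    · rw [indicator_of_notMem (fun h'' => absurd h''.2 (not_lt.2 h')),
        lagrangian_zero hU (hL.trans hLD).le hL.le]

/-- By `heq`, the wealths 0 and L are equally good in the state ξbar; elsewhere the gain of L over 0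
has the sign of ξbar - s. -/
lemma lagrangian_le_threeRegion_mid (hU : IsUtility U) (hD : 0 < D) (ht : IsTangentPoint U D t)
    (hDL : D < L) (hLt : L ≤ t) (hlam : 0 < lam) (hξbar : 0 < ξbar)
    (hb : deriv U (L - D) / lam ≤ ξbar)
    (heq : lam₂ * ξbar * L = lam * ξbar * L - U (L - D)) (hs : 0 < s) (hw : 0 ≤ w) :
    lagrangian U D L (lam * s) (lam₂ * s) w ≤ lagrangian U D L (lam * s) (lam₂ * s)
      (threeRegion U D L (deriv U (L - D) / lam) ξbar lam s) := by
  have hp : 0 < lam * s := mul_pos hlam hs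
  have hL : 0 < L := hD.trans hDL
  have hUL : 0 ≤ U (L - D) := hU.nonneg (sub_pos.2 hDL).le
  have key1 : s ≤ ξbar → -(lam₂ * s * L) ≤ U (L - D) - lam * s * L := by
    intro h
    refine le_of_mul_le_mul_right ?_ hξbar
    nlinarith
  have key2 : ξbar ≤ s → U (L - D) - lam * s * L ≤ -(lam₂ * s * L) := by
    intro h
    refine le_of_mul_le_mul_right ?_ hξbar
    nlinarith
  rcases lt_or_ge s (deriv U (L - D) / lam) with h | h
  · rw [threeRegion, indicator_of_mem (show s ∈ Iio _ from h),
      indicator_of_notMem (fun h' => absurd h (not_lt.2 h'.1)), add_zero]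
    have hs' : s ≤ ξbar := h.le.trans hb
    rw [lt_div_iff₀ hlam, mul_comm] at h
    have hI := (hU.le_inverseMarginal_iff (sub_pos.2 hDL) hp).2 h.le
    rw [lagrangian_inverseMarginal_of_ge hU hp (by linarith)]
    refine (lagrangian_le_of_mid ht hU hD hDL hLt hp hw).trans (max_le ?_ le_rfl)
    exact (key1 hs').trans (hU.sub_mul_le_conjugate hp hDL.le)
  · rw [threeRegion, indicator_of_notMem (show s ∉ Iio _ from not_lt.2 h), zero_add]
    have hp' := h
    rw [div_le_iff₀ hlam, mul_comm] at hp'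
    refine (lagrangian_le_of_mid_of_deriv_le ht hU hD hDL hLt hp' hw).trans ?_
    rcases lt_or_ge s ξbar with h' | h'
    · rw [indicator_of_mem (show s ∈ Ico _ _ from ⟨h, h'⟩), lagrangian_of_ge_of_ge hDL.le le_rfl]
      exact max_le (key1 h'.le) le_rfl
    · rw [indicator_of_notMem (fun h'' => absurd h''.2 (not_lt.2 h')),
        lagrangian_zero hU hD.le hL.le]
      exact max_le le_rfl (key2 h')

/-- The benchmark wealth maximizes the Lagrangian of the unconstrained problem. -/
lemma lagrangian_le_benchmark (hU : IsUtility U) (hD : 0 < D) (ht : IsTangentPoint U D t)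
    (hlam : 0 < lam) (hs : 0 < s) (hw : 0 ≤ w) :
    lagrangian U D L (lam * s) (0 * s) w ≤
      lagrangian U D L (lam * s) (0 * s) (benchmark U D t lam s) := by
  have hp : 0 < lam * s := mul_pos hlam hs
  simp only [lagrangian, zero_mul, sub_zero]
  have hmax : U (max (w - D) 0) - lam * s * w ≤ max 0 (conjugate U (lam * s) - lam * s * D) := by
    rcases le_total w D with h | h
    · rw [max_eq_right (sub_nonpos.2 h), hU.zero]
      exact le_max_of_le_left (by nlinarith)
    · rw [max_eq_left (sub_nonneg.2 h)]
      exact le_max_of_le_right (hU.sub_mul_le_conjugate hp h)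
  refine hmax.trans ?_
  rcases lt_or_ge s (deriv U (t - D) / lam) with h | h
  · rw [benchmark, twoRegion, indicator_of_mem (show s ∈ Iio _ from h)]
    rw [lt_div_iff₀ hlam, mul_comm] at h
    have h1 := ht.mul_le_conjugate hU hD hp h.le
    rw [add_sub_cancel_right, max_eq_left (hU.inverseMarginal_pos hp).le, conjugate]
    exact max_le (by linarith) (by linarith)
  · rw [benchmark, twoRegion, indicator_of_notMem (show s ∉ Iio _ from not_lt.2 h)]
    rw [div_le_iff₀ hlam, mul_comm] at h
    have h1 := ht.conjugate_le_mul hU hD h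
    rw [zero_sub, max_eq_right (a := -D) (by linarith), hU.zero, conjugate]
    exact max_le (by linarith) (by linarith)

lemma IsTangentPoint.deriv_lt (ht : IsTangentPoint U D t) (hU : IsUtility U) (htL : t < L) :
    deriv U (L - D) < deriv U (t - D) :=
  hU.deriv_strictAntiOn (sub_pos.2 ht.1) (sub_pos.2 (ht.1.trans htL)) (by linarith)

/-- Beyond the tangent point, the tangent to the surplus utility at L meets the vertical axis at or
above 0; this is what makes L preferable to default. -/
lemma IsTangentPoint.deriv_mul_le (ht : IsTangentPoint U D t) (hU : IsUtility U) (hD : 0 < D)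
    (htL : t < L) : deriv U (L - D) * L ≤ U (L - D) := by
  have hl : 0 < L - D := sub_pos.2 (ht.1.trans htL)
  have := ht.mul_le_conjugate hU hD (hU.deriv_pos hl) (ht.deriv_lt hU htL).le
  rw [hU.inverseMarginal_deriv hl] at this
  linarith

/-! ### The four regimes when the level exceeds the tangent point -/

section High

variable {p q : ℝ}

lemma lagrangian_le_inverseMarginal_of_lt (hU : IsUtility U) (hD : 0 < D)
    (ht : IsTangentPoint U D t) (htL : t < L) (hq : 0 ≤ q) (hqp : q < p)
    (hp : p < deriv U (L - D)) (hw : 0 ≤ w) :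
    lagrangian U D L p q w ≤ lagrangian U D L p q (inverseMarginal U p + D) := by
  have hDL := ht.1.trans htL
  have hp0 : 0 < p := hq.trans_lt hqp
  have hI := (hU.le_inverseMarginal_iff (sub_pos.2 hDL) hp0).2 hp.le
  rw [lagrangian_inverseMarginal_of_ge hU hp0 (by linarith)]
  have hL := hU.sub_mul_le_conjugate hp0 hDL.le
  have h1 := ht.deriv_mul_le hU hD htL
  rcases le_total w D with h | h
  · rw [lagrangian_of_le_of_le hU h (h.trans hDL.le)]
    nlinarith
  · have := hU.sub_mul_le_conjugate hp0 h
    rcases le_total w L with h' | h'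
    · rw [lagrangian_of_ge_of_le h h']
      nlinarith
    · rwa [lagrangian_of_ge_of_ge h h']

/-- The Lagrangian has a kink at L: a unit of wealth costs p - q below and p above. When U'(L - D)
lies between these two prices, neither direction improves on L. -/
lemma lagrangian_le_level (hU : IsUtility U) (hD : 0 < D)
    (ht : IsTangentPoint U D t) (htL : t < L)
    (hpq : p - q ≤ deriv U (L - D)) (hqp : q ≤ p) (hp : deriv U (L - D) ≤ p) (hw : 0 ≤ w) :
    lagrangian U D L p q w ≤ lagrangian U D L p q L := by
  have hDL := ht.1.trans htL
  rw [lagrangian_of_ge_of_ge hDL.le le_rfl]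
  have h1 := ht.deriv_mul_le hU hD htL
  rcases le_total w D with h | h
  · rw [lagrangian_of_le_of_le hU h (h.trans hDL.le)]
    nlinarith
  · have := hU.le_tangent_of_le hDL h
    rcases le_total w L with h' | h'
    · rw [lagrangian_of_ge_of_le h h']
      nlinarith
    · rw [lagrangian_of_ge_of_ge h h']
      nlinarith

/-- The effective price p - q is high enough to push the optimum below the kink, but not above the
tangent slope where default takes over. -/
lemma lagrangian_le_inverseMarginal_of_ge (hU : IsUtility U) (hD : 0 < D)
    (ht : IsTangentPoint U D t) (htL : t < L) (hq : 0 ≤ q)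
    (hpq : deriv U (L - D) ≤ p - q) (hpq' : p - q ≤ deriv U (t - D)) (hw : 0 ≤ w) :
    lagrangian U D L p q w ≤ lagrangian U D L p q (inverseMarginal U (p - q) + D) := by
  have hDL := ht.1.trans htL
  have hz : 0 < p - q := (hU.deriv_pos (sub_pos.2 hDL)).trans_le hpq
  have hI := (hU.inverseMarginal_le_iff (sub_pos.2 hDL) hz).2 hpq
  have hI0 := hU.inverseMarginal_pos hz
  rw [lagrangian_of_ge_of_le (w := inverseMarginal U (p - q) + D) (by linarith) (by linarith),
    add_sub_cancel_right]
  have h1 := ht.mul_le_conjugate hU hD hz hpq'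
  rcases le_total w D with h | h
  · rw [lagrangian_of_le_of_le hU h (h.trans hDL.le)]
    nlinarith
  · have h2 := hU.sub_mul_le (sub_nonneg.2 h) hz
    rcases le_total w L with h' | h'
    · rw [lagrangian_of_ge_of_le h h']
      nlinarith
    · rw [lagrangian_of_ge_of_ge h h']
      nlinarith

lemma lagrangian_le_default (hU : IsUtility U) (hD : 0 < D)
    (ht : IsTangentPoint U D t) (htL : t < L) (hq : 0 ≤ q)
    (hpq : deriv U (t - D) ≤ p - q) (hw : 0 ≤ w) :
    lagrangian U D L p q w ≤ lagrangian U D L p q 0 := by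
  have hDL := ht.1.trans htL
  have hz : 0 < p - q := (ht.slope_pos hU).trans_le hpq
  rw [lagrangian_zero hU hD.le (hD.trans hDL).le]
  rcases le_total w D with h | h
  · rw [lagrangian_of_le_of_le hU h (h.trans hDL.le)]
    nlinarith
  · have h2 := ht.le_line hU hD (sub_nonneg.2 h)
    rw [sub_add_cancel] at h2
    rcases le_total w L with h' | h'
    · rw [lagrangian_of_ge_of_le h h']
      nlinarith
    · rw [lagrangian_of_ge_of_ge h h']
      nlinarith

end High

/-- The four values of the solution for `t < L`. -/
lemma wealthHigh_cases (hU : IsUtility U) (ht : IsTangentPoint U D t) (htL : t < L)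
    (hlam₂ : 0 ≤ lam₂) (hlam : lam₂ < lam) (s : ℝ) (hs : 0 < s) :
    (lam * s < deriv U (L - D) ∧ wealthHigh U D t L lam lam₂ s = inverseMarginal U (lam * s) + D) ∨
    (deriv U (L - D) ≤ lam * s ∧ (lam - lam₂) * s < deriv U (L - D) ∧
      wealthHigh U D t L lam lam₂ s = L) ∨
    (deriv U (L - D) ≤ (lam - lam₂) * s ∧ (lam - lam₂) * s < deriv U (t - D) ∧
      wealthHigh U D t L lam lam₂ s = inverseMarginal U ((lam - lam₂) * s) + D) ∨
    (deriv U (t - D) ≤ (lam - lam₂) * s ∧ wealthHigh U D t L lam lam₂ s = 0) := by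
  have h0 : 0 < lam := hlam₂.trans_lt hlam
  have hz : 0 < lam - lam₂ := sub_pos.2 hlam
  have hk := ht.deriv_lt hU htL
  have hle : (lam - lam₂) * s ≤ lam * s := by nlinarith
  simp only [wealthHigh, indicator_apply, mem_Iio, mem_Ico, lt_div_iff₀ h0, lt_div_iff₀ hz,
    div_le_iff₀ h0, div_le_iff₀ hz, mul_comm s]
  rcases lt_or_ge (lam * s) (deriv U (L - D)) with h | h
  · left
    simp [h, not_le.2 h, not_le.2 (hle.trans_lt h)]
  right
  rcases lt_or_ge ((lam - lam₂) * s) (deriv U (L - D)) with h' | h'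
  · left
    simp [h, h', not_lt.2 h, not_le.2 h']
  right
  rcases lt_or_ge ((lam - lam₂) * s) (deriv U (t - D)) with h'' | h''
  · left
    simp [h', h'', not_lt.2 h, not_lt.2 h']
  · right
    simp [h'', not_lt.2 h, not_lt.2 h', not_lt.2 h'']

lemma lagrangian_le_wealthHigh (hU : IsUtility U) (hD : 0 < D) (ht : IsTangentPoint U D t)
    (htL : t < L) (hlam₂ : 0 ≤ lam₂) (hlam : lam₂ < lam) (hs : 0 < s) (hw : 0 ≤ w) :
    lagrangian U D L (lam * s) (lam₂ * s) w ≤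
      lagrangian U D L (lam * s) (lam₂ * s) (wealthHigh U D t L lam lam₂ s) := by
  have hq : 0 ≤ lam₂ * s := mul_nonneg hlam₂ hs.le
  have hqp : lam₂ * s < lam * s := by gcongr
  have hz : (lam - lam₂) * s = lam * s - lam₂ * s := by ring
  rcases wealthHigh_cases hU ht htL hlam₂ hlam s hs with
    ⟨h, e⟩ | ⟨h, h', e⟩ | ⟨h, h', e⟩ | ⟨h, e⟩ <;> rw [e]
  · exact lagrangian_le_inverseMarginal_of_lt hU hD ht htL hq hqp h hw
  · exact lagrangian_le_level hU hD ht htL (hz ▸ h'.le) hqp.le h hw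
  · rw [hz] at h h' ⊢
    exact lagrangian_le_inverseMarginal_of_ge hU hD ht htL hq h h'.le hw
  · exact lagrangian_le_default hU hD ht htL hq (hz ▸ h) hw

/-- The three values of the limit of the solution for `t < L`. -/
lemma wealthHighLimit_cases (hU : IsUtility U) (ht : IsTangentPoint U D t) (htL : t < L)
    (hlam : 0 < lam) (s : ℝ) :
    (lam * s < deriv U (L - D) ∧ wealthHighLimit U D t L lam s = L) ∨
    (deriv U (L - D) ≤ lam * s ∧ lam * s < deriv U (t - D) ∧
      wealthHighLimit U D t L lam s = inverseMarginal U (lam * s) + D) ∨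
    (deriv U (t - D) ≤ lam * s ∧ wealthHighLimit U D t L lam s = 0) := by
  have hk := ht.deriv_lt hU htL
  simp only [wealthHighLimit, indicator_apply, mem_Iio, mem_Ico, lt_div_iff₀ hlam,
    div_le_iff₀ hlam, mul_comm s]
  rcases lt_or_ge (lam * s) (deriv U (L - D)) with h | h
  · left
    simp [h, not_le.2 h]
  right
  rcases lt_or_ge (lam * s) (deriv U (t - D)) with h' | h'
  · left
    simp [h, h', not_lt.2 h]
  · right
    simp [h', not_lt.2 h, not_lt.2 h']

/-- Among the wealths at most `L`, the limit wealth for `t < L` maximizes the Lagrangian of the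
unconstrained problem. -/
lemma lagrangian_le_wealthHighLimit (hU : IsUtility U) (hD : 0 < D) (ht : IsTangentPoint U D t)
    (htL : t < L) (hlam : 0 < lam) (hs : 0 < s) (hw : 0 ≤ w) (hwL : w ≤ L) :
    lagrangian U D L (lam * s) (0 * s) w ≤
      lagrangian U D L (lam * s) (0 * s) (wealthHighLimit U D t L lam s) := by
  have hp : 0 < lam * s := mul_pos hlam hs
  have hDL := ht.1.trans htL
  rw [zero_mul]
  have hz : lam * s = lam * s - 0 := (sub_zero _).symm
  rcases wealthHighLimit_cases hU ht htL hlam s with ⟨h, e⟩ | ⟨h, h', e⟩ | ⟨h, e⟩ <;> rw [e]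
  · rw [lagrangian_of_ge_of_ge hDL.le le_rfl]
    have h1 := ht.deriv_mul_le hU hD htL
    rcases le_total w D with h' | h'
    · rw [lagrangian_of_le_of_le hU h' hwL]
      nlinarith
    · have := hU.le_tangent_of_le hDL h'
      rw [lagrangian_of_ge_of_le h' hwL]
      nlinarith
  · rw [hz] at h h'
    have := lagrangian_le_inverseMarginal_of_ge hU hD ht htL le_rfl h h'.le hw
    rwa [sub_zero] at this
  · exact lagrangian_le_default hU hD ht htL le_rfl (hz ▸ h) hw

/-- Among the wealths at most `L`, the limit wealth for `D < L ≤ t` maximizes the Lagrangian of the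
unconstrained problem. -/
lemma lagrangian_le_wealthLimit_mid (hU : IsUtility U) (hD : 0 < D) (ht : IsTangentPoint U D t)
    (hDL : D < L) (hLt : L ≤ t) (hξbar : 0 < ξbar) (hs : 0 < s) (hw : 0 ≤ w) (hwL : w ≤ L) :
    lagrangian U D L (U (L - D) / (L * ξbar) * s) (0 * s) w ≤
      lagrangian U D L (U (L - D) / (L * ξbar) * s) (0 * s) (wealthLimit L ξbar s) := by
  have hL : 0 < L := hD.trans hDL
  have hU0 : 0 ≤ U (L - D) := hU.nonneg (sub_pos.2 hDL).le
  have hval : U (L - D) / (L * ξbar) * s * L = U (L - D) * (s / ξbar) := by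
    field_simp
  rw [zero_mul]
  refine (lagrangian_le_of_mid_of_le ht hU hD hDL hLt hw hwL).trans ?_
  rw [hval, wealthLimit]
  rcases lt_or_ge s ξbar with h | h
  · rw [indicator_of_mem (show s ∈ Iio _ from h), lagrangian_of_ge_of_ge hDL.le le_rfl, hval]
    refine max_le ?_ le_rfl
    have : s / ξbar ≤ 1 := (div_le_one hξbar).2 h.le
    nlinarith
  · rw [indicator_of_notMem (show s ∉ Iio _ from not_lt.2 h), lagrangian_zero hU hD.le hL.le]
    refine max_le le_rfl ?_
    have : 1 ≤ s / ξbar := (one_le_div hξbar).2 h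
    nlinarith

/-- For `L ≤ D` no wealth at most `L` produces a surplus. -/
lemma lagrangian_le_wealthLimit_low (hU : IsUtility U) (hLD : L ≤ D) (hwL : w ≤ L) :
    lagrangian U D L (0 * s) (0 * s) w ≤
      lagrangian U D L (0 * s) (0 * s) (wealthLimit L ξbar s) := by
  simp only [lagrangian, zero_mul, sub_zero]
  rw [max_eq_right (by linarith), hU.zero]
  exact hU.nonneg (le_max_right _ _)

end Profiles

end SurplusES

/-! ### Pricing kernel and bounds on the candidate wealths -/

namespace SurplusES

/-- The properties of the state price density used by the optimization. -/
structure IsPricingKernel {Ω : Type*} [MeasurableSpace Ω] (P : Measure Ω) (ξ : Ω → ℝ) : Prop where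
  measurable : Measurable ξ
  pos : ∀ᵐ ω ∂P, 0 < ξ ω
  integrable : Integrable ξ P
  ne : ∀ c : ℝ, ∀ᵐ ω ∂P, ξ ω ≠ c

/-- Terminal wealths as functions of the state price, between `0` and `max (I (lam x) + D) L`. -/
structure IsProfile (U : ℝ → ℝ) (D L lam : ℝ) (W : ℝ → ℝ) : Prop where
  measurable : Measurable W
  nonneg : ∀ x, 0 < x → 0 ≤ W x
  le : ∀ x, 0 < x → W x ≤ max (inverseMarginal U (lam * x) + D) L

section Kernel

variable {Ω : Type*} [MeasurableSpace Ω] {P Q : Measure Ω}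

lemma isPricingKernel_statePriceDensity [IsProbabilityMeasure Q] {r : ℝ → ℝ} {T : ℝ}
    (hatom : ∀ c : ℝ, P {ω | statePriceDensity P Q r T ω = c} = 0) :
    IsPricingKernel P (statePriceDensity P Q r T) where
  measurable := (Measure.measurable_rnDeriv Q P).ennreal_toReal.const_mul _
  pos := by
    -- Strict positivity comes from the absence of an atom at 0.
    have h0 : ∀ᵐ ω ∂P, statePriceDensity P Q r T ω ≠ 0 := ae_iff.2 (by simpa using hatom 0)
    filter_upwards [h0] with ω hω
    exact lt_of_le_of_ne (mul_nonneg (Real.exp_pos _).le ENNReal.toReal_nonneg) hω.symm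
  integrable := Measure.integrable_toReal_rnDeriv.const_mul _
  ne c := ae_iff.2 (by simpa using hatom c)

lemma integral_statePriceDensity [IsProbabilityMeasure P] [IsProbabilityMeasure Q] (hQP : Q ≪ P)
    (r : ℝ → ℝ) (T : ℝ) :
    ∫ ω, statePriceDensity P Q r T ω ∂P = Real.exp (-∫ s in (0 : ℝ)..T, r s) := by
  simp only [statePriceDensity]
  rw [integral_const_mul, Measure.integral_toReal_rnDeriv hQP]
  simp

end Kernel

section Profile

variable {U : ℝ → ℝ} {D L lam : ℝ} {W : ℝ → ℝ}

/-- `I` is decreasing, so one small multiplier bounds a whole family; this provides the dominating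
function for limits in the multiplier. -/
lemma IsProfile.mono (h : IsProfile U D L lam W) (hU : IsUtility U) {lam' : ℝ} (h0 : 0 < lam')
    (hle : lam' ≤ lam) : IsProfile U D L lam' W where
  measurable := h.measurable
  nonneg := h.nonneg
  le x hx := (h.le x hx).trans (max_le_max (add_le_add_left
    (hU.inverseMarginal_le (mul_pos h0 hx) (by gcongr)) _) le_rfl)

lemma IsUtility.continuous_max (hU : IsUtility U) : Continuous fun x => U (max x 0) :=
  hU.continuousOn.comp_continuous (by fun_prop) (fun x => le_max_right x 0)

lemma IsUtility.measurable_inverseMarginal_mul (hU : IsUtility U) (lam : ℝ) :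
    Measurable fun x => inverseMarginal U (lam * x) :=
  hU.measurable_inverseMarginal.comp (measurable_id.const_mul lam)

lemma measurable_twoRegion (hU : IsUtility U) (D b lam : ℝ) : Measurable (twoRegion U D b lam) :=
  ((hU.measurable_inverseMarginal_mul lam).add_const D).indicator measurableSet_Iio

lemma measurable_threeRegion (hU : IsUtility U) (D L a b lam : ℝ) :
    Measurable (threeRegion U D L a b lam) :=
  (measurable_twoRegion hU D a lam).add (measurable_const.indicator measurableSet_Ico)

lemma isProfile_twoRegion (hU : IsUtility U) (hD : 0 ≤ D) (hL : 0 ≤ L) (hlam : 0 < lam) (b : ℝ) :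
    IsProfile U D L lam (twoRegion U D b lam) where
  measurable := measurable_twoRegion hU D b lam
  nonneg x hx := by
    have := hU.inverseMarginal_pos (mul_pos hlam hx)
    rw [twoRegion, indicator_apply]
    split_ifs <;> linarith
  le x hx := by
    rw [twoRegion, indicator_apply]
    split_ifs
    exacts [le_max_left _ _, hL.trans (le_max_right _ _)]

lemma isProfile_threeRegion (hU : IsUtility U) (hD : 0 ≤ D) (hL : 0 ≤ L) (hlam : 0 < lam)
    (a b : ℝ) : IsProfile U D L lam (threeRegion U D L a b lam) where
  measurable := measurable_threeRegion hU D L a b lam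
  nonneg x hx := by
    have := hU.inverseMarginal_pos (mul_pos hlam hx)
    simp only [threeRegion, indicator_apply]
    split_ifs <;> linarith
  le x hx := by
    simp only [threeRegion, indicator_apply, mem_Iio, mem_Ico]
    split_ifs with h1 h2
    · exact absurd h1 (not_lt.2 h2.1)
    · simp
    · simp
    · simpa using Or.inr hL

lemma isProfile_wealthLimit (hL : 0 ≤ L) (b : ℝ) : IsProfile U D L lam (wealthLimit L b) where
  measurable := measurable_const.indicator measurableSet_Iio
  nonneg x _ := indicator_nonneg (fun _ _ => hL) x
  le x _ := le_max_of_le_right (indicator_le_self' (fun _ _ => hL) x)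

variable {t : ℝ}

lemma isProfile_wealthHighLimit (hU : IsUtility U) (hD : 0 < D) (ht : IsTangentPoint U D t)
    (htL : t < L) (hlam : 0 < lam) : IsProfile U D L lam (wealthHighLimit U D t L lam) where
  measurable := (measurable_const.indicator measurableSet_Iio).add
    (((hU.measurable_inverseMarginal_mul lam).add_const D).indicator measurableSet_Ico)
  nonneg x hx := by
    have := hU.inverseMarginal_pos (mul_pos hlam hx)
    have := ht.1
    rcases wealthHighLimit_cases hU ht htL hlam x with ⟨-, e⟩ | ⟨-, -, e⟩ | ⟨-, e⟩ <;> rw [e] <;>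
      linarith
  le x hx := by
    have := ht.1
    rcases wealthHighLimit_cases hU ht htL hlam x with ⟨-, e⟩ | ⟨-, -, e⟩ | ⟨-, e⟩ <;> rw [e]
    · simp
    · simp
    · exact le_max_of_le_right (by linarith)

lemma wealthHighLimit_le (hU : IsUtility U) (hD : 0 < D) (ht : IsTangentPoint U D t)
    (htL : t < L) (hlam : 0 < lam) {x : ℝ} (hx : 0 < x) : wealthHighLimit U D t L lam x ≤ L := by
  have h := ht.1
  rcases wealthHighLimit_cases hU ht htL hlam x with ⟨-, e⟩ | ⟨h', -, e⟩ | ⟨-, e⟩ <;> rw [e]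
  · have := (hU.inverseMarginal_le_iff (sub_pos.2 (h.trans htL)) (mul_pos hlam hx)).2 h'
    linarith
  · linarith

lemma isProfile_wealthHigh (hU : IsUtility U) (hD : 0 < D) (ht : IsTangentPoint U D t)
    (htL : t < L) {lam₂ : ℝ} (hlam₂ : 0 ≤ lam₂) (hlam : lam₂ < lam) :
    IsProfile U D L lam (wealthHigh U D t L lam lam₂) where
  measurable := ((((hU.measurable_inverseMarginal_mul lam).add_const D).indicator
    measurableSet_Iio).add (measurable_const.indicator measurableSet_Ico)).add
    (((hU.measurable_inverseMarginal_mul (lam - lam₂)).add_const D).indicator measurableSet_Ico)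
  nonneg x hx := by
    have := hU.inverseMarginal_pos (mul_pos (hlam₂.trans_lt hlam) hx)
    have := hU.inverseMarginal_pos (mul_pos (sub_pos.2 hlam) hx)
    have := ht.1
    rcases wealthHigh_cases hU ht htL hlam₂ hlam x hx with
      ⟨-, e⟩ | ⟨-, -, e⟩ | ⟨-, -, e⟩ | ⟨-, e⟩ <;> rw [e] <;> linarith
  le x hx := by
    have := ht.1
    rcases wealthHigh_cases hU ht htL hlam₂ hlam x hx with
      ⟨-, e⟩ | ⟨-, -, e⟩ | ⟨h, -, e⟩ | ⟨-, e⟩ <;> rw [e]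
    · simp
    · simp
    · have := (hU.inverseMarginal_le_iff (sub_pos.2 (this.trans htL))
        (mul_pos (sub_pos.2 hlam) hx)).2 h
      exact le_max_of_le_right (by linarith)
    · exact le_max_of_le_right (by linarith)

/-- The shortfall of the solution for `t < L` depends only on `lam - lam₂`. -/
lemma max_sub_wealthHigh (hU : IsUtility U) (hD : 0 < D) (ht : IsTangentPoint U D t)
    (htL : t < L) {lam₂ : ℝ} (hlam₂ : 0 ≤ lam₂) (hlam : lam₂ < lam) {x : ℝ} (hx : 0 < x) :
    max (L - wealthHigh U D t L lam lam₂ x) 0 = L - wealthHighLimit U D t L (lam - lam₂) x := by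
  have hz := sub_pos.2 hlam
  have h0 := ht.1
  have hk := ht.deriv_lt hU htL
  have hle : (lam - lam₂) * x ≤ lam * x := by nlinarith
  have hl : 0 < L - D := by linarith
  rcases wealthHigh_cases hU ht htL hlam₂ hlam x hx with
    -- The limit wealth is that of the multiplier λ - λ₂, so its regions match those of the
    -- four-region wealth, with the first two merged; the other combinations are contradictory.
    ⟨h, e⟩ | ⟨h, h', e⟩ | ⟨h, h', e⟩ | ⟨h, e⟩ <;>
  rcases wealthHighLimit_cases hU ht htL hz x with ⟨g, e'⟩ | ⟨g, g', e'⟩ | ⟨g, e'⟩ <;>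
  rw [e, e'] <;> try (exfalso; linarith)
  · have := (hU.le_inverseMarginal_iff hl (mul_pos (hlam₂.trans_lt hlam) hx)).2 h.le
    rw [max_eq_right (by linarith), sub_self]
  · simp
  · have := (hU.inverseMarginal_le_iff hl (mul_pos hz hx)).2 h
    rw [max_eq_left (by linarith)]
  · rw [max_eq_left (by linarith)]

/-- For λ₂ = 0 the two thresholds of the L-region coincide, and the two surplus regions join. -/
lemma wealthHigh_zero (hU : IsUtility U) (ht : IsTangentPoint U D t) (htL : t < L)
    (hlam : 0 < lam) {x : ℝ} (hx : 0 < x) :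
    wealthHigh U D t L lam 0 x = benchmark U D t lam x := by
  have hk := ht.deriv_lt hU htL
  simp only [benchmark, twoRegion, indicator_apply, mem_Iio, lt_div_iff₀ hlam, mul_comm x]
  rcases wealthHigh_cases hU ht htL le_rfl hlam x hx with
    ⟨h, e⟩ | ⟨h, h', e⟩ | ⟨h, h', e⟩ | ⟨h, e⟩ <;> rw [e] <;> try rw [sub_zero] at *
  · rw [if_pos (h.trans hk)]
  · exact absurd h' (not_lt.2 h)
  · rw [if_pos h']
  · rw [if_neg (not_lt.2 h)]

lemma benchmark_le (hU : IsUtility U) (hD : 0 ≤ D) {lam' : ℝ}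
    (hlam : 0 < lam) (hle : lam ≤ lam') {x : ℝ} (hx : 0 < x) :
    benchmark U D t lam' x ≤ benchmark U D t lam x := by
  have hlam' := hlam.trans_le hle
  have hmul : lam * x ≤ lam' * x := by gcongr
  have h1 := hU.inverseMarginal_le (mul_pos hlam hx) hmul
  have h2 := hU.inverseMarginal_pos (mul_pos hlam hx)
  simp only [benchmark, twoRegion, indicator_apply, mem_Iio, lt_div_iff₀ hlam, lt_div_iff₀ hlam',
    mul_comm x]
  split_ifs <;> linarith

lemma benchmark_lt (hU : IsUtility U) {lam' : ℝ}
    (hlam : 0 < lam) (hlt : lam < lam') {x : ℝ} (hx : 0 < x) (h0 : benchmark U D t lam' x ≠ 0) :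
    benchmark U D t lam' x < benchmark U D t lam x := by
  have hlam' := hlam.trans hlt
  have hmul : lam * x < lam' * x := by gcongr
  have h1 := hU.inverseMarginal_strictAntiOn (mul_pos hlam hx) (mul_pos hlam' hx) hmul
  simp only [benchmark, twoRegion, indicator_apply, mem_Iio, lt_div_iff₀ hlam, lt_div_iff₀ hlam',
    mul_comm x] at h0 ⊢
  split_ifs at h0 ⊢ <;> first | linarith | exact absurd rfl h0

end Profile

/-! ### From pointwise maximality to optimality -/

section Optimal

variable {Ω : Type*} [MeasurableSpace Ω] {P : Measure Ω} {ξ : Ω → ℝ} {U : ℝ → ℝ} {D L : ℝ}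

lemma IsProfile.integrable {lam : ℝ} {W : ℝ → ℝ} (hW : IsProfile U D L lam W)
    (hξ : IsPricingKernel P ξ) (hU : IsUtility U)
    (hξI : ∀ lam : ℝ, 0 < lam → Integrable (fun ω => ξ ω * inverseMarginal U (lam * ξ ω)) P)
    (hD : 0 ≤ D) (hL : 0 ≤ L) (hlam : 0 < lam) : Integrable (fun ω => ξ ω * W (ξ ω)) P := by
  refine ((hξI lam hlam).add (hξ.integrable.mul_const (D + L))).mono'
    (hξ.measurable.mul (hW.measurable.comp hξ.measurable)).aestronglyMeasurable ?_
  filter_upwards [hξ.pos] with ω hω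
  have h1 := hU.inverseMarginal_pos (mul_pos hlam hω)
  have h2 : W (ξ ω) ≤ inverseMarginal U (lam * ξ ω) + (D + L) :=
    (hW.le _ hω).trans (max_le (by linarith) (by linarith))
  rw [Real.norm_of_nonneg (mul_nonneg hω.le (hW.nonneg _ hω)), Pi.add_apply, ← mul_add]
  gcongr

lemma IsProfile.integrable_utility [IsFiniteMeasure P] {lam : ℝ} {W : ℝ → ℝ}
    (hW : IsProfile U D L lam W) (hξ : IsPricingKernel P ξ) (hU : IsUtility U)
    (hUI : ∀ lam : ℝ, 0 < lam → Integrable (fun ω => U (inverseMarginal U (lam * ξ ω))) P)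
    (hD : 0 ≤ D) (hL : 0 ≤ L) (hlam : 0 < lam) :
    Integrable (fun ω => U (max (W (ξ ω) - D) 0)) P := by
  refine ((hUI lam hlam).add (integrable_const (U L))).mono'
    (hU.continuous_max.measurable.comp
      ((hW.measurable.comp hξ.measurable).sub_const D)).aestronglyMeasurable ?_
  filter_upwards [hξ.pos] with ω hω
  have h1 := (hU.inverseMarginal_pos (mul_pos hlam hω)).le
  rw [Real.norm_of_nonneg (hU.nonneg (le_max_right _ _)), Pi.add_apply]
  have h2 : max (W (ξ ω) - D) 0 ≤ max (inverseMarginal U (lam * ξ ω)) L := by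
    refine max_le ?_ (le_max_of_le_left h1)
    have := hW.le _ hω
    rcases le_max_iff.1 this with h | h
    · exact le_max_of_le_left (by linarith)
    · exact le_max_of_le_right (by linarith)
  refine (hU.mono (le_max_right _ _) h2).trans ?_
  have h3 := hU.nonneg h1
  have h4 := hU.nonneg hL
  rcases max_cases (inverseMarginal U (lam * ξ ω)) L with ⟨h, -⟩ | ⟨h, -⟩ <;> rw [h] <;> linarith

lemma shortfall_eq (P : Measure Ω) (ξ : Ω → ℝ) (L : ℝ) (X : Ω → ℝ) :
    shortfall P ξ L X = ∫ ω, ξ ω * max (L - X ω) 0 ∂P := by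
  refine integral_congr_ae (Eventually.of_forall fun ω => ?_)
  simp only [indicator_apply, mem_ofPred_eq]
  split_ifs with h
  · rw [max_eq_left (by linarith)]
  · rw [max_eq_right (by linarith), mul_zero]

lemma integrable_shortfall (hξ : IsPricingKernel P ξ) (hL : 0 ≤ L) {X : Ω → ℝ} (hX : Measurable X)
    (hX0 : ∀ᵐ ω ∂P, 0 ≤ X ω) : Integrable (fun ω => ξ ω * max (L - X ω) 0) P := by
  refine (hξ.integrable.mul_const L).mono'
    (hξ.measurable.mul ((hX.const_sub L).max measurable_const)).aestronglyMeasurable ?_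
  filter_upwards [hξ.pos, hX0] with ω hω h0
  rw [Real.norm_of_nonneg (mul_nonneg hω.le (le_max_right _ _))]
  have : max (L - X ω) 0 ≤ L := max_le (by linarith) hL
  gcongr

lemma IsProfile.nonneg_ae {lam : ℝ} {W : ℝ → ℝ} (hW : IsProfile U D L lam W)
    (hξ : IsPricingKernel P ξ) : ∀ᵐ ω ∂P, 0 ≤ W (ξ ω) := by
  filter_upwards [hξ.pos] with ω hω using hW.nonneg _ hω

/-- A wealth which maximizes the Lagrangian in almost every state, against every feasible wealth,
is optimal. -/
lemma isOptimal_of_lagrangian [IsFiniteMeasure P] {ε x₀ lam lam₀ lam₂ : ℝ} {W : ℝ → ℝ}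
    (hξ : IsPricingKernel P ξ) (hU : IsUtility U)
    (hUI : ∀ lam : ℝ, 0 < lam → Integrable (fun ω => U (inverseMarginal U (lam * ξ ω))) P)
    (hξI : ∀ lam : ℝ, 0 < lam → Integrable (fun ω => ξ ω * inverseMarginal U (lam * ξ ω)) P)
    (hD : 0 ≤ D) (hL : 0 ≤ L) (hlam₀ : 0 < lam₀) (hW : IsProfile U D L lam₀ W)
    (hprice : price P ξ (fun ω => W (ξ ω)) = x₀)
    (hsf : shortfall P ξ L (fun ω => W (ξ ω)) ≤ ε) (hlam₂ : 0 ≤ lam₂)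
    (hslack : lam₂ = 0 ∨ shortfall P ξ L (fun ω => W (ξ ω)) = ε)
    (hmax : ∀ Y, IsFeasible P ξ L ε x₀ Y → ∀ᵐ ω ∂P,
      lagrangian U D L (lam * ξ ω) (lam₂ * ξ ω) (Y ω) ≤
        lagrangian U D L (lam * ξ ω) (lam₂ * ξ ω) (W (ξ ω))) :
    IsOptimal P ξ U D L ε x₀ (fun ω => W (ξ ω)) := by
  have hXm : Measurable fun ω => W (ξ ω) := hW.measurable.comp hξ.measurable
  have hXi := hW.integrable hξ hU hξI hD hL hlam₀
  have hui := hW.integrable_utility hξ hU hUI hD hL hlam₀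
  have hu0 : 0 ≤ᵐ[P] fun ω => U (max (W (ξ ω) - D) 0) :=
    Eventually.of_forall fun ω => hU.nonneg (le_max_right _ _)
  have hval : expectedUtility P U D (fun ω => W (ξ ω)) =
      ENNReal.ofReal (∫ ω, U (max (W (ξ ω) - D) 0) ∂P) :=
    (ofReal_integral_eq_lintegral_ofReal hui hu0).symm
  refine ⟨⟨⟨hXm, hW.nonneg_ae hξ, hXi, hprice⟩, hsf, hprice.le⟩, ?_, fun Y hY => ?_⟩
  · rw [hval]
    exact ENNReal.ofReal_lt_top
  · have hYi := hY.attainable.integrable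
    have hsX := integrable_shortfall hξ hL hXm (hW.nonneg_ae hξ)
    have hsY := integrable_shortfall hξ hL hY.attainable.measurable hY.attainable.nonneg
    -- The Lagrangian inequality solved for the utility of Y. The utility of Y is not known to be
    -- integrable, but `g` is and dominates it.
    set g : Ω → ℝ := fun ω => (U (max (W (ξ ω) - D) 0) + lam * (ξ ω * Y ω - ξ ω * W (ξ ω))) +
      lam₂ * (ξ ω * max (L - Y ω) 0 - ξ ω * max (L - W (ξ ω)) 0) with hg
    have hi1 : Integrable (fun ω => lam * (ξ ω * Y ω - ξ ω * W (ξ ω))) P :=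
      (hYi.sub hXi).const_mul lam
    have hi2 : Integrable
        (fun ω => lam₂ * (ξ ω * max (L - Y ω) 0 - ξ ω * max (L - W (ξ ω)) 0)) P :=
      (hsY.sub hsX).const_mul lam₂
    have hi3 : Integrable (fun ω => U (max (W (ξ ω) - D) 0) +
        lam * (ξ ω * Y ω - ξ ω * W (ξ ω))) P := hui.add hi1
    have hgi : Integrable g P := hi3.add hi2
    have hle : ∀ᵐ ω ∂P, U (max (Y ω - D) 0) ≤ g ω := by
      filter_upwards [hmax Y hY] with ω hω
      simp only [lagrangian] at hω
      simp only [hg]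
      linarith
    have hint : ∫ ω, g ω ∂P ≤ ∫ ω, U (max (W (ξ ω) - D) 0) ∂P := by
      have e1 : ∫ ω, ξ ω * Y ω ∂P = x₀ := hY.attainable.price_eq
      have e2 : ∫ ω, ξ ω * W (ξ ω) ∂P = x₀ := hprice
      have e3 := shortfall_eq P ξ L Y
      have e4 := shortfall_eq P ξ L (fun ω => W (ξ ω))
      have e : ∫ ω, g ω ∂P = ∫ ω, U (max (W (ξ ω) - D) 0) ∂P + lam * (x₀ - x₀) +
          lam₂ * (shortfall P ξ L Y - shortfall P ξ L (fun ω => W (ξ ω))) := by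
        simp only [hg]
        rw [integral_add hi3 hi2, integral_add hui hi1, integral_const_mul,
          integral_const_mul, integral_sub hYi hXi, integral_sub hsY hsX, e1, e2, e3, e4]
      rw [e]
      have := hY.shortfall_le
      rcases hslack with h | h
      · rw [h]
        linarith
      · rw [h]
        nlinarith
    calc expectedUtility P U D Y ≤ ∫⁻ ω, ENNReal.ofReal (g ω) ∂P := by
          refine lintegral_mono_ae ?_
          filter_upwards [hle] with ω hω using ENNReal.ofReal_le_ofReal hω
      _ = ENNReal.ofReal (∫ ω, g ω ∂P) := by
          refine (ofReal_integral_eq_lintegral_ofReal hgi ?_).symm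
          filter_upwards [hle] with ω hω
          exact (hU.nonneg (le_max_right _ _)).trans hω
      _ ≤ _ := by
          rw [hval]
          exact ENNReal.ofReal_le_ofReal hint

/-- With the minimal initial capital no feasible wealth exceeds `L`. -/
lemma IsFeasible.le_level {ε : ℝ} {Y : Ω → ℝ} (hξ : IsPricingKernel P ξ) (hL : 0 ≤ L)
    (hY : IsFeasible P ξ L ε (L * ∫ ω, ξ ω ∂P - ε) Y) : ∀ᵐ ω ∂P, Y ω ≤ L := by
  have hsY := integrable_shortfall hξ hL hY.attainable.measurable hY.attainable.nonneg
  have hi' : Integrable (fun ω => ξ ω * L - ξ ω * Y ω) P :=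
    (hξ.integrable.mul_const L).sub hY.attainable.integrable
  -- The integrand is ξ (Y - L)^+. Budget and shortfall constraint make its integral nonpositive, so
  -- it vanishes almost surely.
  have hi : Integrable (fun ω => ξ ω * max (L - Y ω) 0 - (ξ ω * L - ξ ω * Y ω)) P :=
    hsY.sub hi'
  have h0 : 0 ≤ᵐ[P] fun ω => ξ ω * max (L - Y ω) 0 - (ξ ω * L - ξ ω * Y ω) := by
    filter_upwards [hξ.pos] with ω hω
    have := mul_le_mul_of_nonneg_left (le_max_left (L - Y ω) 0) hω.le
    simp only [Pi.zero_apply]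
    linarith
  have hle : ∫ ω, (ξ ω * max (L - Y ω) 0 - (ξ ω * L - ξ ω * Y ω)) ∂P ≤ 0 := by
    have e1 := hY.attainable.price_eq
    have e2 := hY.shortfall_le
    rw [shortfall_eq] at e2
    rw [price] at e1
    rw [integral_sub hsY hi',
      integral_sub (hξ.integrable.mul_const L) hY.attainable.integrable, integral_mul_const, e1]
    linarith
  have hz := (integral_eq_zero_iff_of_nonneg_ae h0 hi).1
    (le_antisymm hle (integral_nonneg_of_ae h0))
  filter_upwards [hz, hξ.pos] with ω hω hp
  simp only [Pi.zero_apply] at hω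
  have : ξ ω * (max (L - Y ω) 0 - (L - Y ω)) = 0 := by linarith
  rcases mul_eq_zero.1 this with h | h
  · exact absurd h hp.ne'
  · have := le_max_right (L - Y ω) 0
    linarith

end Optimal

/-! ### Continuity of prices in the multiplier -/

section Continuity

variable {Ω : Type*} [MeasurableSpace Ω] {P : Measure Ω} {ξ : Ω → ℝ}
  {U : ℝ → ℝ} {D L : ℝ}

lemma tendsto_price (hξ : IsPricingKernel P ξ) (hU : IsUtility U)
    (hξI : ∀ lam : ℝ, 0 < lam → Integrable (fun ω => ξ ω * inverseMarginal U (lam * ξ ω)) P)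
    (hD : 0 ≤ D) (hL : 0 ≤ L) {W : ℝ → ℝ → ℝ} {W' : ℝ → ℝ} {l : Filter ℝ}
    [l.IsCountablyGenerated] {lam₀ : ℝ} (hlam₀ : 0 < lam₀)
    (hW : ∀ᶠ lam in l, IsProfile U D L lam₀ (W lam))
    (hlim : ∀ᵐ ω ∂P, Tendsto (fun lam => W lam (ξ ω)) l (𝓝 (W' (ξ ω)))) :
    Tendsto (fun lam => price P ξ fun ω => W lam (ξ ω)) l (𝓝 (price P ξ fun ω => W' (ξ ω))) := by
  refine tendsto_integral_filter_of_dominated_convergence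
    (fun ω => ξ ω * (inverseMarginal U (lam₀ * ξ ω)) + ξ ω * (D + L)) ?_ ?_
    ((hξI lam₀ hlam₀).add (hξ.integrable.mul_const _)) ?_
  · filter_upwards [hW] with lam h
    exact (hξ.measurable.mul (h.measurable.comp hξ.measurable)).aestronglyMeasurable
  · filter_upwards [hW] with lam h
    filter_upwards [hξ.pos] with ω hω
    have h1 := hU.inverseMarginal_pos (mul_pos hlam₀ hω)
    have h2 : W lam (ξ ω) ≤ inverseMarginal U (lam₀ * ξ ω) + (D + L) :=
      (h.le _ hω).trans (max_le (by linarith) (by linarith))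
    rw [Real.norm_of_nonneg (mul_nonneg hω.le (h.nonneg _ hω)), ← mul_add]
    gcongr
  · filter_upwards [hlim] with ω hω using hω.const_mul _

lemma continuousOn_price (hξ : IsPricingKernel P ξ) (hU : IsUtility U)
    (hξI : ∀ lam : ℝ, 0 < lam → Integrable (fun ω => ξ ω * inverseMarginal U (lam * ξ ω)) P)
    (hD : 0 ≤ D) (hL : 0 ≤ L) {W : ℝ → ℝ → ℝ} {S : Set ℝ} (hS : ∀ lam ∈ S, 0 < lam)
    (hW : ∀ lam ∈ S, IsProfile U D L lam (W lam))
    (hcont : ∀ lam ∈ S, ∀ᵐ ω ∂P, ContinuousAt (fun lam => W lam (ξ ω)) lam) :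
    ContinuousOn (fun lam => price P ξ fun ω => W lam (ξ ω)) S := by
  intro lam hlam
  have h0 := hS lam hlam
  -- Near `lam` all multipliers exceed `lam / 2`, whose bound serves them all.
  refine tendsto_price hξ hU hξI hD hL (lam₀ := lam / 2) (by linarith) ?_ ?_
  · filter_upwards [self_mem_nhdsWithin,
      nhdsWithin_le_nhds (Ioi_mem_nhds (show lam / 2 < lam by linarith))] with l hlS hl
    exact (hW l hlS).mono hU (by linarith) (le_of_lt hl)
  · filter_upwards [hcont lam hlam] with ω hω using hω.continuousWithinAt

/-- The intermediate value theorem for the price of a family of wealths with a limit. -/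
lemma exists_price_eq (hξ : IsPricingKernel P ξ) (hU : IsUtility U)
    (hξI : ∀ lam : ℝ, 0 < lam → Integrable (fun ω => ξ ω * inverseMarginal U (lam * ξ ω)) P)
    (hD : 0 ≤ D) (hL : 0 ≤ L) {W : ℝ → ℝ → ℝ} {S : Set ℝ} (hS : ∀ lam ∈ S, 0 < lam)
    (hS' : IsPreconnected S) (hStop : S ∈ atTop)
    (hW : ∀ lam ∈ S, IsProfile U D L lam (W lam))
    (hcont : ∀ lam ∈ S, ∀ᵐ ω ∂P, ContinuousAt (fun lam => W lam (ξ ω)) lam)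
    {V : ℝ → ℝ} (hlim : ∀ x, 0 < x → Tendsto (fun lam => W lam x) atTop (𝓝 (V x)))
    {lam₁ x₀ : ℝ} (h₁ : lam₁ ∈ S) (hx₁ : x₀ ≤ price P ξ fun ω => W lam₁ (ξ ω))
    (hx₀ : price P ξ (fun ω => V (ξ ω)) < x₀) :
    ∃ lam ∈ S, price P ξ (fun ω => W lam (ξ ω)) = x₀ := by
  have hc := continuousOn_price hξ hU hξI hD hL hS hW hcont
  have ht : Tendsto (fun lam => price P ξ fun ω => W lam (ξ ω)) atTop
      (𝓝 (price P ξ fun ω => V (ξ ω))) := by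
    refine tendsto_price hξ hU hξI hD hL (hS _ h₁) ?_ ?_
    · filter_upwards [hStop, eventually_ge_atTop lam₁] with l hlS hl
      exact (hW l hlS).mono hU (hS _ h₁) hl
    · filter_upwards [hξ.pos] with ω hω using hlim _ hω
  exact hS'.intermediate_value_Ioc h₁ (by simpa using hStop) hc ht ⟨hx₀, hx₁⟩

/-- Away from the thresholds, membership in a moving region is locally constant in the multiplier.
The excluded states are null since ξ has no atoms. -/
lemma continuousAt_indicator {S : ℝ → Set ℝ} {g : ℝ → ℝ → ℝ} {x lam : ℝ}
    (hS : ∀ᶠ l in 𝓝 lam, (x ∈ S l ↔ x ∈ S lam)) (hg : ContinuousAt (fun l => g l x) lam) :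
    ContinuousAt (fun l => (S l).indicator (g l) x) lam := by
  by_cases hx : x ∈ S lam
  · refine hg.congr ?_
    filter_upwards [hS] with l hl
    rw [indicator_of_mem (hl.2 hx)]
  · refine (continuousAt_const (y := (0 : ℝ))).congr ?_
    filter_upwards [hS] with l hl
    rw [indicator_of_notMem (fun h => hx (hl.1 h))]

lemma eventually_lt_iff {b : ℝ → ℝ} {x lam : ℝ} (hb : ContinuousAt b lam) (hx : x ≠ b lam) :
    ∀ᶠ l in 𝓝 lam, (x < b l ↔ x < b lam) := by
  rcases lt_or_gt_of_ne hx with h | h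
  · filter_upwards [hb.eventually (lt_mem_nhds h)] with l hl
    exact iff_of_true hl h
  · filter_upwards [hb.eventually (gt_mem_nhds h)] with l hl
    exact iff_of_false (not_lt.2 hl.le) (not_lt.2 h.le)

lemma continuousAt_indicator_Iio {b : ℝ → ℝ} {g : ℝ → ℝ → ℝ} {x lam : ℝ} (hb : ContinuousAt b lam)
    (hx : x ≠ b lam) (hg : ContinuousAt (fun l => g l x) lam) :
    ContinuousAt (fun l => (Iio (b l)).indicator (g l) x) lam :=
  continuousAt_indicator (eventually_lt_iff hb hx) hg

lemma continuousAt_indicator_Ico {a b : ℝ → ℝ} {g : ℝ → ℝ → ℝ} {x lam : ℝ}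
    (ha : ContinuousAt a lam) (hxa : x ≠ a lam) (hb : ContinuousAt b lam)
    (hxb : x ≠ b lam) (hg : ContinuousAt (fun l => g l x) lam) :
    ContinuousAt (fun l => (Ico (a l) (b l)).indicator (g l) x) lam := by
  refine continuousAt_indicator ?_ hg
  filter_upwards [eventually_lt_iff ha hxa, eventually_lt_iff hb hxb] with l h1 h2
  rw [mem_Ico, mem_Ico, ← not_lt, ← not_lt, h1, h2]

lemma IsUtility.continuousAt_inverseMarginal_mul (hU : IsUtility U) {lam x : ℝ} (hlam : 0 < lam)
    (hx : 0 < x) (D : ℝ) : ContinuousAt (fun l => inverseMarginal U (l * x) + D) lam := by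
  have h : ContinuousAt (fun l => inverseMarginal U (l * x)) lam :=
    ContinuousAt.comp (f := fun l => l * x) (hU.continuousAt_inverseMarginal (mul_pos hlam hx))
      (by fun_prop)
  exact h.add continuousAt_const

lemma IsUtility.tendsto_inverseMarginal_mul (hU : IsUtility U) {x : ℝ} (hx : 0 < x) (D : ℝ) :
    Tendsto (fun l => inverseMarginal U (l * x) + D) atTop (𝓝 D) := by
  simpa using (hU.tendsto_inverseMarginal_atTop.comp (tendsto_id.atTop_mul_const hx)).add_const D

end Continuity

end SurplusES

/-! ### Existence of the default threshold and of the critical multiplier -/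

namespace SurplusES

/-- The standing assumptions of the ES-constrained problem. -/
structure IsProblem {Ω : Type*} [MeasurableSpace Ω] (P : Measure Ω) (ξ : Ω → ℝ) (U : ℝ → ℝ)
    (D L ε : ℝ) : Prop where
  kernel : IsPricingKernel P ξ
  utility : IsUtility U
  integrable_utility :
    ∀ lam : ℝ, 0 < lam → Integrable (fun ω => U (inverseMarginal U (lam * ξ ω))) P
  integrable_wealth :
    ∀ lam : ℝ, 0 < lam → Integrable (fun ω => ξ ω * inverseMarginal U (lam * ξ ω)) P
  D_pos : 0 < D
  L_pos : 0 < L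
  ε_pos : 0 < ε
  ε_lt : ε < L * ∫ ω, ξ ω ∂P

namespace IsProblem

variable {Ω : Type*} [MeasurableSpace Ω] {P : Measure Ω} {ξ : Ω → ℝ}
  {U : ℝ → ℝ} {D L ε t : ℝ}

lemma integrable (h : IsProblem P ξ U D L ε) {lam : ℝ} {W : ℝ → ℝ}
    (hW : IsProfile U D L lam W) (hlam : 0 < lam) : Integrable (fun ω => ξ ω * W (ξ ω)) P :=
  hW.integrable h.kernel h.utility h.integrable_wealth h.D_pos.le h.L_pos.le hlam

lemma price_mono (h : IsProblem P ξ U D L ε) {lam lam' : ℝ} {V W : ℝ → ℝ}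
    (hV : IsProfile U D L lam V) (hlam : 0 < lam) (hW : IsProfile U D L lam' W) (hlam' : 0 < lam')
    (hle : ∀ x, 0 < x → V x ≤ W x) :
    price P ξ (fun ω => V (ξ ω)) ≤ price P ξ (fun ω => W (ξ ω)) := by
  refine integral_mono_ae (h.integrable hV hlam) (h.integrable hW hlam') ?_
  filter_upwards [h.kernel.pos] with ω hω
  exact mul_le_mul_of_nonneg_left (hle _ hω) hω.le

lemma integral_sub_eq (h : IsProblem P ξ U D L ε) {lam : ℝ} {V : ℝ → ℝ}
    (hV : IsProfile U D L lam V) (hlam : 0 < lam) :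
    ∫ ω, ξ ω * (L - V (ξ ω)) ∂P = L * ∫ ω, ξ ω ∂P - price P ξ (fun ω => V (ξ ω)) := by
  simp only [mul_sub]
  rw [integral_sub (h.kernel.integrable.mul_const L) (h.integrable hV hlam), integral_mul_const,
    mul_comm, price]

/-- `V` is `W` truncated at L, and for a wealth at most L the shortfall is affine. Binding
constraints thus become statements that the limit wealths have the minimal price. -/
lemma shortfall_eq_sub_price (h : IsProblem P ξ U D L ε) {lam : ℝ} {V W : ℝ → ℝ}
    (hV : IsProfile U D L lam V) (hlam : 0 < lam)
    (heq : ∀ x, 0 < x → max (L - W x) 0 = L - V x) :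
    shortfall P ξ L (fun ω => W (ξ ω)) = L * ∫ ω, ξ ω ∂P - price P ξ (fun ω => V (ξ ω)) := by
  rw [shortfall_eq, ← h.integral_sub_eq hV hlam]
  refine integral_congr_ae ?_
  filter_upwards [h.kernel.pos] with ω hω
  rw [heq _ hω]

lemma shortfall_le_sub_price (h : IsProblem P ξ U D L ε) {lam lam' : ℝ} {V W : ℝ → ℝ}
    (hV : IsProfile U D L lam V) (hlam : 0 < lam) (hW : IsProfile U D L lam' W)
    (hle : ∀ x, 0 < x → max (L - W x) 0 ≤ L - V x) :
    shortfall P ξ L (fun ω => W (ξ ω)) ≤ L * ∫ ω, ξ ω ∂P - price P ξ (fun ω => V (ξ ω)) := by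
  rw [shortfall_eq, ← h.integral_sub_eq hV hlam]
  have hi : Integrable (fun ω => ξ ω * (L - V (ξ ω))) P := by
    simp only [mul_sub]
    exact (h.kernel.integrable.mul_const L).sub (h.integrable hV hlam)
  refine integral_mono_ae (integrable_shortfall h.kernel h.L_pos.le
    (hW.measurable.comp h.kernel.measurable) (hW.nonneg_ae h.kernel)) hi ?_
  filter_upwards [h.kernel.pos] with ω hω
  exact mul_le_mul_of_nonneg_left (hle _ hω) hω.le

lemma integral_default_eq (h : IsProblem P ξ U D L ε) (b : ℝ) :
    ∫ ω, {ω | b ≤ ξ ω}.indicator (fun ω => L * ξ ω) ω ∂P =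
      L * ∫ ω, ξ ω ∂P - price P ξ (fun ω => wealthLimit L b (ξ ω)) := by
  rw [← h.integral_sub_eq (isProfile_wealthLimit h.L_pos.le b) one_pos]
  refine integral_congr_ae (Eventually.of_forall fun ω => ?_)
  simp only [wealthLimit, indicator_apply, mem_ofPred_eq, mem_Iio]
  by_cases hb : b ≤ ξ ω
  · rw [if_pos hb, if_neg (not_lt.2 hb)]
    ring
  · rw [if_neg hb, if_pos (not_le.1 hb)]
    ring

lemma isDefaultThreshold_iff (h : IsProblem P ξ U D L ε) {b : ℝ} :
    IsDefaultThreshold P ξ L ε b ↔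
      0 < b ∧ price P ξ (fun ω => wealthLimit L b (ξ ω)) = L * ∫ ω, ξ ω ∂P - ε := by
  rw [IsDefaultThreshold, h.integral_default_eq]
  refine and_congr_right fun _ => ?_
  constructor <;> intro _ <;> linarith

lemma isCriticalMultiplier_iff (h : IsProblem P ξ U D L ε) (ht : IsTangentPoint U D t)
    (htL : t < L) {lam : ℝ} :
    IsCriticalMultiplier P ξ U D t L ε lam ↔
      0 < lam ∧ price P ξ (fun ω => wealthHighLimit U D t L lam (ξ ω)) = L * ∫ ω, ξ ω ∂P - ε := by
  rw [IsCriticalMultiplier]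
  refine and_congr_right fun hlam => ?_
  have e := h.integral_sub_eq (isProfile_wealthHighLimit h.utility h.D_pos ht htL hlam) hlam
  have hk := ht.deriv_lt h.utility htL
  have e' : ∀ᵐ ω ∂P, ({ω | ξ ω * lam < deriv U (t - D) ∧ deriv U (L - D) ≤ ξ ω * lam}.indicator
        (fun ω => ξ ω * (L - inverseMarginal U (lam * ξ ω) - D)) ω
      + {ω | deriv U (t - D) ≤ ξ ω * lam}.indicator (fun ω => ξ ω * L) ω) =
      ξ ω * (L - wealthHighLimit U D t L lam (ξ ω)) := by
    filter_upwards with ω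
    simp only [indicator_apply, mem_ofPred_eq, mul_comm _ lam]
    rcases wealthHighLimit_cases h.utility ht htL hlam (ξ ω) with
      ⟨g, e⟩ | ⟨g, g', e⟩ | ⟨g, e⟩ <;> rw [e]
    · rw [if_neg (fun hh => absurd hh.2 (not_le.2 g)), if_neg (not_le.2 (g.trans hk))]
      ring
    · rw [if_pos ⟨g', g⟩, if_neg (not_le.2 g')]
      ring
    · rw [if_neg (fun hh => absurd hh.1 (not_lt.2 g)), if_pos g]
      ring
  rw [integral_congr_ae e', e]
  constructor <;> intro _ <;> linarith

/-- The price of L 1_{ξ < b} runs continuously from 0 to L E[ξ] as b goes from 0 to ∞, and 0 < ε < L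
E[ξ]. -/
lemma exists_isDefaultThreshold (h : IsProblem P ξ U D L ε) :
    ∃ b, IsDefaultThreshold P ξ L ε b := by
  simp only [h.isDefaultThreshold_iff]
  have hcont := continuousOn_price h.kernel h.utility h.integrable_wealth h.D_pos.le h.L_pos.le
    (W := fun b => wealthLimit L b) (S := Ioi 0) (fun _ hb => hb)
    (fun b _ => isProfile_wealthLimit h.L_pos.le b) (fun b _ => by
      filter_upwards [h.kernel.ne b] with ω hω
      exact continuousAt_indicator_Iio (b := fun b => b) continuousAt_id hω continuousAt_const)
  have h0 := tendsto_price h.kernel h.utility h.integrable_wealth h.D_pos.le h.L_pos.le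
    (W := fun b => wealthLimit L b) (W' := fun _ => 0) (l := 𝓝[>] 0) one_pos
    (Eventually.of_forall fun b => isProfile_wealthLimit h.L_pos.le b) (by
      filter_upwards [h.kernel.pos] with ω hω
      refine tendsto_const_nhds.congr' ?_
      filter_upwards [Ioo_mem_nhdsGT hω] with b hb
      exact (indicator_of_notMem (fun hh => absurd hb.2 (not_lt.2 (le_of_lt hh))) (fun _ => L)).symm)
  have h1 := tendsto_price h.kernel h.utility h.integrable_wealth h.D_pos.le h.L_pos.le
    (W := fun b => wealthLimit L b) (W' := fun _ => L) (l := atTop) one_pos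
    (Eventually.of_forall fun b => isProfile_wealthLimit h.L_pos.le b) (by
      filter_upwards with ω
      refine tendsto_const_nhds.congr' ?_
      filter_upwards [Ioi_mem_atTop (ξ ω)] with b hb
      exact (indicator_of_mem (show ξ ω ∈ Iio b from hb) (fun _ => L)).symm)
  simp only [price, mul_zero, integral_zero, integral_mul_const] at h0 h1
  have := isPreconnected_Ioi.intermediate_value_Ioo (s := Ioi (0 : ℝ))
    (l₁ := 𝓝[>] (0 : ℝ)) (l₂ := atTop) inf_le_right
    (by simpa using Ioi_mem_atTop (0 : ℝ)) hcont h0 h1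
  obtain ⟨b, hb, hb'⟩ := this ⟨sub_pos.2 h.ε_lt, by linarith [h.ε_pos]⟩
  exact ⟨b, hb, hb'⟩

/-- In each state the limit wealth equals L for small multipliers and 0 for large ones, so its price
covers the interval between 0 and L E[ξ]. -/
lemma exists_isCriticalMultiplier (h : IsProblem P ξ U D L ε) (ht : IsTangentPoint U D t)
    (htL : t < L) : ∃ lam, IsCriticalMultiplier P ξ U D t L ε lam := by
  simp only [h.isCriticalMultiplier_iff ht htL]
  have hU := h.utility
  have hl : 0 < deriv U (L - D) := hU.deriv_pos (sub_pos.2 (ht.1.trans htL))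
  have hk := ht.slope_pos hU
  have hprof : ∀ lam, 0 < lam → IsProfile U D L lam (wealthHighLimit U D t L lam) :=
    fun lam hlam => isProfile_wealthHighLimit hU h.D_pos ht htL hlam
  have hcont := continuousOn_price h.kernel hU h.integrable_wealth h.D_pos.le h.L_pos.le
    (W := fun lam => wealthHighLimit U D t L lam) (S := Ioi 0) (fun _ hb => hb)
    (fun lam hlam => hprof lam hlam) (fun lam hlam => by
      have hlam' : (0 : ℝ) < lam := hlam
      have hd : ∀ c : ℝ, ContinuousAt (fun l => c / l) lam :=
        fun c => continuousAt_const.div continuousAt_id hlam'.ne'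
      filter_upwards [h.kernel.pos, h.kernel.ne (deriv U (L - D) / lam),
        h.kernel.ne (deriv U (t - D) / lam)] with ω h0 h1 h2
      exact (continuousAt_indicator_Iio (hd _) h1 continuousAt_const).add
        (continuousAt_indicator_Ico (g := fun l x => inverseMarginal U (l * x) + D) (hd _) h1
          (hd _) h2 (hU.continuousAt_inverseMarginal_mul hlam' h0 D)))
  have h1 := tendsto_price h.kernel hU h.integrable_wealth h.D_pos.le h.L_pos.le
    (W := fun lam => wealthHighLimit U D t L lam) (W' := fun _ => 0) (l := atTop) one_pos
    (by
      filter_upwards [eventually_ge_atTop 1] with lam hlam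
      exact (hprof lam (by linarith)).mono hU one_pos hlam) (by
      filter_upwards [h.kernel.pos] with ω hω
      refine tendsto_const_nhds.congr' ?_
      filter_upwards [eventually_gt_atTop 0, eventually_ge_atTop (deriv U (t - D) / ξ ω)]
        with lam hlam hle
      rw [div_le_iff₀ hω] at hle
      have hkl := ht.deriv_lt hU htL
      rcases wealthHighLimit_cases hU ht htL hlam (ξ ω) with ⟨g, e⟩ | ⟨g, g', e⟩ | ⟨g, e⟩
      · linarith
      · linarith
      · exact e.symm)
  have h0 := tendsto_price h.kernel hU h.integrable_wealth h.D_pos.le h.L_pos.le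
    (W := fun lam => wealthHighLimit U D t L lam) (W' := fun _ => L) (l := 𝓝[>] 0) one_pos
    (by
      filter_upwards [self_mem_nhdsWithin] with lam hlam
      -- The bound through I(lam x) degenerates as lam → 0; the bound by L does not.
      exact ⟨(hprof lam hlam).measurable, (hprof lam hlam).nonneg, fun x hx =>
        le_max_of_le_right (wealthHighLimit_le hU h.D_pos ht htL hlam hx)⟩) (by
      filter_upwards [h.kernel.pos] with ω hω
      refine tendsto_const_nhds.congr' ?_
      filter_upwards [Ioo_mem_nhdsGT (div_pos hl hω)] with lam hlam
      have hlt := hlam.2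
      rw [lt_div_iff₀ hω] at hlt
      have hkl := ht.deriv_lt hU htL
      rcases wealthHighLimit_cases hU ht htL hlam.1 (ξ ω) with ⟨g, e⟩ | ⟨g, g', e⟩ | ⟨g, e⟩
      · exact e.symm
      · linarith
      · linarith)
  simp only [price, mul_zero, integral_zero, integral_mul_const] at h0 h1
  have := isPreconnected_Ioi.intermediate_value_Ioo (s := Ioi (0 : ℝ))
    (l₁ := atTop) (l₂ := 𝓝[>] (0 : ℝ)) (by simpa using Ioi_mem_atTop (0 : ℝ)) inf_le_right hcont h1 h0
  obtain ⟨b, hb, hb'⟩ := this ⟨sub_pos.2 h.ε_lt, by linarith [h.ε_pos]⟩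
  exact ⟨b, hb, hb'⟩

lemma isOptimal [IsFiniteMeasure P] (h : IsProblem P ξ U D L ε) {x₀ lam lam₀ lam₂ : ℝ} {W : ℝ → ℝ}
    (hlam₀ : 0 < lam₀) (hW : IsProfile U D L lam₀ W)
    (hprice : price P ξ (fun ω => W (ξ ω)) = x₀)
    (hsf : shortfall P ξ L (fun ω => W (ξ ω)) ≤ ε) (hlam₂ : 0 ≤ lam₂)
    (hslack : lam₂ = 0 ∨ shortfall P ξ L (fun ω => W (ξ ω)) = ε)
    (hmax : ∀ s w, 0 < s → 0 ≤ w → lagrangian U D L (lam * s) (lam₂ * s) w ≤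
        lagrangian U D L (lam * s) (lam₂ * s) (W s)) :
    IsOptimal P ξ U D L ε x₀ (fun ω => W (ξ ω)) := by
  refine isOptimal_of_lagrangian (lam := lam) h.kernel h.utility h.integrable_utility h.integrable_wealth
    h.D_pos.le h.L_pos.le hlam₀ hW hprice hsf hlam₂ hslack fun Y hY => ?_
  filter_upwards [h.kernel.pos, hY.attainable.nonneg] with ω h0 hY0
  exact hmax _ _ h0 hY0

/-- With the minimal initial capital, maximizing the Lagrangian among the wealths at most `L` is
enough for optimality. -/
lemma isOptimal_of_le [IsFiniteMeasure P] (h : IsProblem P ξ U D L ε) {lam lam₀ : ℝ} {W : ℝ → ℝ}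
    (hlam₀ : 0 < lam₀) (hW : IsProfile U D L lam₀ W) (hWL : ∀ x, 0 < x → W x ≤ L)
    (hprice : price P ξ (fun ω => W (ξ ω)) = L * ∫ ω, ξ ω ∂P - ε)
    (hmax : ∀ s w, 0 < s → 0 ≤ w → w ≤ L → lagrangian U D L (lam * s) (0 * s) w ≤
        lagrangian U D L (lam * s) (0 * s) (W s)) :
    IsOptimal P ξ U D L ε (L * ∫ ω, ξ ω ∂P - ε) (fun ω => W (ξ ω)) := by
  have hsf := h.shortfall_eq_sub_price hW hlam₀ (W := W)
    (fun x hx => max_eq_left (sub_nonneg.2 (hWL x hx)))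
  refine isOptimal_of_lagrangian (lam := lam) h.kernel h.utility h.integrable_utility h.integrable_wealth
    h.D_pos.le h.L_pos.le hlam₀ hW hprice (by linarith) le_rfl (Or.inl rfl) fun Y hY => ?_
  filter_upwards [h.kernel.pos, hY.attainable.nonneg, hY.le_level h.kernel h.L_pos.le]
    with ω h0 hY0 hYL
  exact hmax _ _ h0 hY0 hYL

/-! ### The benchmark wealth when the constraint does not bind -/

section Benchmark

lemma isProfile_benchmark (h : IsProblem P ξ U D L ε) {lam : ℝ} (hlam : 0 < lam) :
    IsProfile U D L lam (benchmark U D t lam) :=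
  isProfile_twoRegion h.utility h.D_pos.le h.L_pos.le hlam _

lemma exists_price_benchmark_eq (h : IsProblem P ξ U D L ε) (ht : IsTangentPoint U D t)
    {lam₁ x₀ : ℝ} (hlam₁ : 0 < lam₁)
    (hpos : 0 < price P ξ (fun ω => wealthLimit L (deriv U (t - D) / lam₁) (ξ ω)))
    (hx₀ : price P ξ (fun ω => benchmark U D t lam₁ (ξ ω)) ≤ x₀) :
    ∃ lam, 0 < lam ∧ price P ξ (fun ω => benchmark U D t lam (ξ ω)) = x₀ := by
  have hU := h.utility
  have hL := h.L_pos
  have hcont := continuousOn_price h.kernel hU h.integrable_wealth h.D_pos.le h.L_pos.le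
    (W := fun lam => benchmark U D t lam) (S := Ioi 0) (fun _ hb => hb)
    (fun lam hlam => h.isProfile_benchmark hlam) (fun lam hlam => by
      have hlam' : (0 : ℝ) < lam := hlam
      filter_upwards [h.kernel.pos, h.kernel.ne (deriv U (t - D) / lam)] with ω h0 h2
      exact continuousAt_indicator_Iio (g := fun l x => inverseMarginal U (l * x) + D)
        (continuousAt_const.div continuousAt_id hlam'.ne') h2
        (hU.continuousAt_inverseMarginal_mul hlam' h0 D))
  have hk := ht.slope_pos hU
  set c := deriv U (t - D) / lam₁ with hc
  have hc0 : 0 < c := div_pos hk hlam₁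
  set p := price P ξ (fun ω => wealthLimit L c (ξ ω))
  -- Wealth at least M on {ξ < c} costs at least M p / L, hence at least x₀. The 1 only keeps M
  -- positive.
  set M := max 1 (x₀ * L / p) with hM
  have hM0 : 0 < M := lt_max_of_lt_left one_pos
  -- The second entry makes I(lam ξ) ≥ M for ξ < c; the first keeps {ξ < c} inside the region
  -- without default.
  set lam := min lam₁ (deriv U M / c) with hlam
  have hlam0 : 0 < lam := lt_min hlam₁ (div_pos (hU.deriv_pos hM0) hc0)
  have hIM : M ≤ inverseMarginal U (lam * c) := by
    rw [hU.le_inverseMarginal_iff hM0 (mul_pos hlam0 hc0), ← le_div_iff₀ hc0]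
    exact min_le_right _ _
  have hle : x₀ ≤ price P ξ (fun ω => benchmark U D t lam (ξ ω)) := by
    have h1 : M / L * p ≤ price P ξ (fun ω => benchmark U D t lam (ξ ω)) := by
      simp only [p, price]
      rw [← integral_const_mul]
      refine integral_mono_ae ((h.integrable (isProfile_wealthLimit hL.le c) one_pos).const_mul _)
        (h.integrable (h.isProfile_benchmark hlam0) hlam0) ?_
      filter_upwards [h.kernel.pos] with ω hω
      have key : M / L * wealthLimit L c (ξ ω) ≤ benchmark U D t lam (ξ ω) := by
        rcases lt_or_ge (ξ ω) c with hlt | hge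
        · have hlt' : ξ ω < deriv U (t - D) / lam := by
            refine hlt.trans_le ?_
            rw [hc]
            gcongr
            exact min_le_left _ _
          rw [wealthLimit, indicator_of_mem (show ξ ω ∈ Iio c from hlt), benchmark, twoRegion,
            indicator_of_mem (show ξ ω ∈ Iio _ from hlt'), div_mul_cancel₀ _ hL.ne']
          have := hU.inverseMarginal_le (mul_pos hlam0 hω)
            (mul_le_mul_of_nonneg_left hlt.le hlam0.le)
          linarith [h.D_pos]
        · rw [wealthLimit, indicator_of_notMem (show ξ ω ∉ Iio c from not_lt.2 hge), mul_zero]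
          exact (h.isProfile_benchmark hlam0).nonneg _ hω
      have := mul_le_mul_of_nonneg_left key hω.le
      linarith
    have h2 : x₀ * L / p ≤ M := le_max_right _ _
    rw [div_le_iff₀ hpos] at h2
    have h3 : x₀ ≤ M / L * p := by
      rw [div_mul_eq_mul_div, le_div_iff₀ hL]
      exact h2
    exact h3.trans h1
  obtain ⟨l, hl, hl'⟩ := isPreconnected_Ioi.intermediate_value
    (show lam₁ ∈ Ioi (0 : ℝ) from hlam₁) (show lam ∈ Ioi (0 : ℝ) from hlam0) hcont ⟨hx₀, hle⟩
  exact ⟨l, hl, hl'⟩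

/-- The benchmark strictly decreases in the multiplier wherever it is nonzero. For lam > lam₁ the
price inequality would force equality almost surely, so the benchmark for lam would vanish,
contradicting its positive price. -/
lemma le_of_price_benchmark_le (h : IsProblem P ξ U D L ε) {lam lam₁ : ℝ}
    (hlam₁ : 0 < lam₁)
    (hpos : 0 < price P ξ (fun ω => benchmark U D t lam (ξ ω)))
    (hle : price P ξ (fun ω => benchmark U D t lam₁ (ξ ω)) ≤
      price P ξ (fun ω => benchmark U D t lam (ξ ω))) : lam ≤ lam₁ := by
  by_contra! hlt
  have hlam := hlam₁.trans hlt
  have hi := h.integrable (h.isProfile_benchmark (t := t) hlam) hlam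
  have hi₁ := h.integrable (h.isProfile_benchmark (t := t) hlam₁) hlam₁
  have h0 : 0 ≤ᵐ[P] fun ω => ξ ω * benchmark U D t lam₁ (ξ ω) - ξ ω * benchmark U D t lam (ξ ω) := by
    filter_upwards [h.kernel.pos] with ω hω
    have := mul_le_mul_of_nonneg_left
      (benchmark_le (t := t) h.utility h.D_pos.le hlam₁ hlt.le hω) hω.le
    simpa using this
  have hz := (integral_eq_zero_iff_of_nonneg_ae h0 (hi₁.sub hi)).1 (by
    refine le_antisymm ?_ (integral_nonneg_of_ae h0)
    rw [integral_sub hi₁ hi]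
    exact sub_nonpos.2 hle)
  have : price P ξ (fun ω => benchmark U D t lam (ξ ω)) = 0 := by
    refine integral_eq_zero_of_ae ?_
    filter_upwards [hz, h.kernel.pos] with ω hω hp
    by_contra hne
    have h1 := benchmark_lt h.utility hlam₁ hlt hp (t := t) (D := D)
      (fun e => hne (by simp [e]))
    have h2 := mul_lt_mul_of_pos_left h1 hp
    simp only [Pi.zero_apply] at hω
    linarith
  linarith

/-- If the initial capital suffices for a benchmark wealth and all benchmark wealths with smaller
multipliers satisfy the shortfall constraint, then the benchmark wealth is optimal. -/
lemma benchmark_optimal [IsFiniteMeasure P] (h : IsProblem P ξ U D L ε) (ht : IsTangentPoint U D t)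
    {lam₁ x₀ : ℝ} (hlam₁ : 0 < lam₁) (hx₀min : L * ∫ ω, ξ ω ∂P - ε ≤ x₀)
    (hpos : 0 < price P ξ (fun ω => wealthLimit L (deriv U (t - D) / lam₁) (ξ ω)))
    (hx₀ : price P ξ (fun ω => benchmark U D t lam₁ (ξ ω)) ≤ x₀)
    (hsf : ∀ lam, 0 < lam → lam ≤ lam₁ →
      shortfall P ξ L (fun ω => benchmark U D t lam (ξ ω)) ≤ ε) :
    (∃ lam, 0 < lam ∧ price P ξ (fun ω => benchmark U D t lam (ξ ω)) = x₀) ∧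
    (∀ lam, 0 < lam → price P ξ (fun ω => benchmark U D t lam (ξ ω)) = x₀ →
      IsOptimal P ξ U D L ε x₀ (fun ω => benchmark U D t lam (ξ ω))) := by
  refine ⟨h.exists_price_benchmark_eq ht hlam₁ hpos hx₀, fun lam hlam hp => ?_⟩
  have hx : 0 < x₀ := (sub_pos.2 h.ε_lt).trans_le hx₀min
  have hle := h.le_of_price_benchmark_le hlam₁ (by rwa [hp]) (by rwa [hp])
  exact h.isOptimal hlam (h.isProfile_benchmark hlam) hp (hsf lam hlam hle) le_rfl (Or.inl rfl)
    fun s w hs hw => lagrangian_le_benchmark h.utility h.D_pos ht hlam hs hw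

end Benchmark

end IsProblem

end SurplusES

/-! ### Families with a fixed default region -/

namespace SurplusES

/-- A family of wealths, indexed by the budget multiplier, which default exactly above the state
price `ξbar`, converge to `L` below it, and solve the Lagrangian problem for multipliers at least
`k / ξbar`. -/
structure IsBindingFamily (U : ℝ → ℝ) (D L k ξbar : ℝ) (W : ℝ → ℝ → ℝ) : Prop where
  profile : ∀ lam, 0 < lam → IsProfile U D L lam (W lam)
  continuousAt : ∀ lam, 0 < lam → ∃ c, ∀ x, 0 < x → x ≠ c → x ≠ ξbar →
    ContinuousAt (fun l => W l x) lam
  tendsto : ∀ x, 0 < x → Tendsto (fun l => W l x) atTop (𝓝 (wealthLimit L ξbar x))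
  eq_twoRegion : ∀ lam, 0 < lam → lam * ξbar ≤ k → W lam = twoRegion U D ξbar lam
  shortfall : ∀ lam x, 0 < lam → 0 < x → max (L - W lam x) 0 = L - wealthLimit L ξbar x
  lagrangian_le : ∀ lam, 0 < lam → k ≤ lam * ξbar → ∃ lam₂, 0 ≤ lam₂ ∧ ∀ s w, 0 < s → 0 ≤ w →
    lagrangian U D L (lam * s) (lam₂ * s) w ≤ lagrangian U D L (lam * s) (lam₂ * s) (W lam s)

section Families

variable {U : ℝ → ℝ} {D L K t ξbar : ℝ}

lemma threeRegion_self (U : ℝ → ℝ) (D L b lam : ℝ) :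
    threeRegion U D L b b lam = twoRegion U D b lam := by
  funext x
  simp [threeRegion, twoRegion]

lemma wealthLow_eq_twoRegion (U : ℝ → ℝ) (D t ξbar lam : ℝ) :
    wealthLow U D D t ξbar lam = twoRegion U D ξbar lam := by
  funext x
  simp [wealthLow]

/-- Capping the lower threshold at ξbar absorbs the two-region case, which makes continuity in the
multiplier visible across the switch. -/
lemma wealthLow_eq_threeRegion (U : ℝ → ℝ) (hLD : L < D) (t ξbar lam : ℝ) :
    wealthLow U D L t ξbar lam =
      threeRegion U D L (min (deriv U (t - (D - L)) / lam) ξbar) ξbar lam := by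
  funext x
  simp only [wealthLow, hLD.ne, false_or]
  split_ifs with h
  · rw [min_eq_right h, threeRegion_self]
  · rw [min_eq_left (not_le.1 h).le]

lemma wealthMid_eq_threeRegion (U : ℝ → ℝ) (D L ξbar lam : ℝ) :
    wealthMid U D L ξbar lam =
      threeRegion U D L (min (deriv U (L - D) / lam) ξbar) ξbar lam := by
  funext x
  simp only [wealthMid]
  split_ifs with h
  · rw [min_eq_right h.le, threeRegion_self]
  · rw [min_eq_left (not_lt.1 h)]

lemma continuousAt_threeRegion (hU : IsUtility U) {lam x : ℝ} (hlam : 0 < lam) (hx : 0 < x)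
    (hxK : x ≠ K / lam) (hxb : x ≠ ξbar) :
    ContinuousAt (fun l => threeRegion U D L (min (K / l) ξbar) ξbar l x) lam := by
  have ha : ContinuousAt (fun l => min (K / l) ξbar) lam :=
    (continuousAt_const.div continuousAt_id hlam.ne').min continuousAt_const
  have hxa : x ≠ min (K / lam) ξbar := by
    rcases min_choice (K / lam) ξbar with h | h <;> rwa [h]
  exact (continuousAt_indicator_Iio (g := fun l x => inverseMarginal U (l * x) + D) ha hxa
    (hU.continuousAt_inverseMarginal_mul hlam hx D)).add
    (continuousAt_indicator_Ico ha hxa continuousAt_const hxb continuousAt_const)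

lemma tendsto_threeRegion {x : ℝ} (hx : 0 < x) :
    Tendsto (fun l => threeRegion U D L (min (K / l) ξbar) ξbar l x) atTop
      (𝓝 (wealthLimit L ξbar x)) := by
  refine tendsto_const_nhds.congr' ?_
  filter_upwards [eventually_ge_atTop (K / x), eventually_gt_atTop 0] with l hl hl0
  rw [div_le_iff₀ hx] at hl
  have h1 : K / l ≤ x := by rwa [div_le_iff₀ hl0, mul_comm]
  rw [threeRegion, indicator_of_notMem (fun h : x ∈ Iio _ => absurd h
    (not_lt.2 ((min_le_left _ _).trans h1))), zero_add, wealthLimit]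
  rcases lt_or_ge x ξbar with h | h
  · rw [indicator_of_mem (show x ∈ Iio ξbar from h),
      indicator_of_mem (show x ∈ Ico _ ξbar from ⟨(min_le_left _ _).trans h1, h⟩)]
  · rw [indicator_of_notMem (show x ∉ Iio ξbar from not_lt.2 h),
      indicator_of_notMem (fun h' => absurd h'.2 (not_lt.2 h))]

lemma max_sub_threeRegion {a lam x : ℝ} (hL : 0 ≤ L) (ha : a ≤ ξbar)
    (hge : x < a → L ≤ inverseMarginal U (lam * x) + D) :
    max (L - threeRegion U D L a ξbar lam x) 0 = L - wealthLimit L ξbar x := by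
  simp only [threeRegion, wealthLimit, indicator_apply, mem_Iio, mem_Ico]
  rcases lt_or_ge x a with h1 | h1
  · rw [if_pos h1, if_neg (fun h => absurd h1 (not_lt.2 h.1)), if_pos (h1.trans_le ha), add_zero,
      max_eq_right (by linarith [hge h1]), sub_self]
  · rw [if_neg (not_lt.2 h1), zero_add]
    rcases lt_or_ge x ξbar with h2 | h2
    · rw [if_pos ⟨h1, h2⟩, if_pos h2, sub_self, max_self]
    · rw [if_neg (fun h => absurd h.2 (not_lt.2 h2)), if_neg (not_lt.2 h2), sub_zero,
        max_eq_left hL]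

/-- The shortfall multiplier which makes default and surplus equally good in the state `ξbar`. -/
lemma exists_lagrangian_le_twoRegion (hU : IsUtility U) (hD : 0 < D) (hL : 0 < L)
    (ht : IsTangentPoint U D t) {lam : ℝ} (hlam : 0 < lam) (hξbar : 0 < ξbar)
    (hk : deriv U (t - D) ≤ lam * ξbar)
    (hconj : lam * ξbar * (D - L) ≤ conjugate U (lam * ξbar))
    (hmax : ∀ p q w, 0 < p → q ≤ p → 0 ≤ w →
      lagrangian U D L p q w ≤ max (-(q * L)) (conjugate U p - p * D))
    (hge : ∀ s, 0 < s → s < ξbar → L ≤ inverseMarginal U (lam * s) + D) :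
    ∃ lam₂, 0 ≤ lam₂ ∧ ∀ s w, 0 < s → 0 ≤ w →
      lagrangian U D L (lam * s) (lam₂ * s) w ≤
        lagrangian U D L (lam * s) (lam₂ * s) (twoRegion U D ξbar lam s) := by
  have h1 := ht.conjugate_le_mul hU hD hk
  have hbL : 0 < ξbar * L := mul_pos hξbar hL
  -- The solution λ₂ of the indifference equation at ξbar. It is nonnegative because λ ξbar is at
  -- least the tangent slope, and at most λ by `hconj`.
  refine ⟨(lam * ξbar * D - conjugate U (lam * ξbar)) / (ξbar * L),
    div_nonneg (sub_nonneg.2 h1) hbL.le, fun s w hs hw => ?_⟩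
  refine lagrangian_le_twoRegion hU hD hL hlam (fun s w hs hw => hmax _ _ _ (mul_pos hlam hs) ?_ hw)
    hge ?_ hξbar hs hw
  · refine mul_le_mul_of_nonneg_right ?_ hs.le
    rw [div_le_iff₀ hbL]
    linarith
  · field_simp

lemma isBindingFamily_wealthLow_self (hU : IsUtility U) (hD : 0 < D) (ht : IsTangentPoint U D t)
    (hξbar : 0 < ξbar) (t' : ℝ) :
    IsBindingFamily U D D (deriv U (t - D)) ξbar (wealthLow U D D t' ξbar) where
  profile lam hlam := by
    rw [wealthLow_eq_twoRegion]
    exact isProfile_twoRegion hU hD.le hD.le hlam _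
  continuousAt lam hlam := by
    simp only [wealthLow_eq_twoRegion]
    exact ⟨0, fun x hx _ hxb => continuousAt_indicator_Iio
      (g := fun l x => inverseMarginal U (l * x) + D) (b := fun _ => ξbar) continuousAt_const hxb
      (hU.continuousAt_inverseMarginal_mul hlam hx D)⟩
  tendsto x hx := by
    simp only [wealthLow_eq_twoRegion, twoRegion, wealthLimit, indicator_apply]
    split_ifs
    exacts [hU.tendsto_inverseMarginal_mul hx D, tendsto_const_nhds]
  eq_twoRegion lam _ _ := wealthLow_eq_twoRegion U D t' ξbar lam
  shortfall lam x hlam hx := by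
    rw [wealthLow_eq_twoRegion, ← threeRegion_self U D D]
    exact max_sub_threeRegion hD.le le_rfl
      (fun _ => by linarith [hU.inverseMarginal_pos (mul_pos hlam hx)])
  lagrangian_le lam hlam hk := by
    simp only [wealthLow_eq_twoRegion]
    refine exists_lagrangian_le_twoRegion hU hD hD ht hlam hξbar hk ?_
      (fun p q w hp hq hw => lagrangian_le_of_le hU hD le_rfl hp hq hw)
      (fun s hs _ => by linarith [hU.inverseMarginal_pos (mul_pos hlam hs)])
    rw [sub_self, mul_zero]
    exact hU.conjugate_nonneg (mul_pos hlam hξbar)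

lemma isBindingFamily_wealthLow_of_lt (hU : IsUtility U) (hL : 0 < L) (hLD : L < D)
    (ht : IsTangentPoint U D t) {t' : ℝ} (ht' : IsTangentPoint U (D - L) t') (hξbar : 0 < ξbar) :
    IsBindingFamily U D L (deriv U (t - D)) ξbar (wealthLow U D L t' ξbar) where
  profile lam hlam := by
    rw [wealthLow_eq_threeRegion U hLD]
    exact isProfile_threeRegion hU (hL.trans hLD).le hL.le hlam _ _
  continuousAt lam hlam := by
    simp only [wealthLow_eq_threeRegion U hLD]
    exact ⟨_, fun x hx hxK hxb => continuousAt_threeRegion hU hlam hx hxK hxb⟩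
  tendsto x hx := by
    simp only [wealthLow_eq_threeRegion U hLD]
    exact tendsto_threeRegion hx
  eq_twoRegion lam hlam hk := by
    -- The slope for D - L is at least the one for D, so λ ξbar ≤ U'(t - D) leaves the L-region
    -- empty.
    have h1 := ht.slope_le hU (hL.trans hLD) ht' (sub_pos.2 hLD) (by linarith)
    rw [wealthLow_eq_threeRegion U hLD, min_eq_right, threeRegion_self]
    rw [le_div_iff₀ hlam]
    linarith
  shortfall lam x hlam hx := by
    rw [wealthLow_eq_threeRegion U hLD]
    exact max_sub_threeRegion hL.le (min_le_right _ _)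
      (fun _ => by linarith [hU.inverseMarginal_pos (mul_pos hlam hx)])
  lagrangian_le lam hlam hk := by
    simp only [wealthLow_eq_threeRegion U hLD]
    have hD := hL.trans hLD
    rcases le_total (deriv U (t' - (D - L)) / lam) ξbar with h | h
    · rw [min_eq_left h]
      exact ⟨lam, hlam.le, fun s w hs hw => lagrangian_le_threeRegion_low hU hL hLD ht' hlam hs hw⟩
    · rw [min_eq_right h, threeRegion_self]
      refine exists_lagrangian_le_twoRegion hU hD hL ht hlam hξbar hk ?_
        (fun p q w hp hq hw => lagrangian_le_of_le hU hL hLD.le hp hq hw)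
        (fun s hs _ => by linarith [hU.inverseMarginal_pos (mul_pos hlam hs)])
      rw [le_div_iff₀ hlam, mul_comm] at h
      exact ht'.mul_le_conjugate hU (sub_pos.2 hLD) (mul_pos hlam hξbar) h

lemma isBindingFamily_wealthLow (hU : IsUtility U) (hL : 0 < L) (hLD : L ≤ D)
    (ht : IsTangentPoint U D t) {t' : ℝ} (ht' : L < D → IsTangentPoint U (D - L) t')
    (hξbar : 0 < ξbar) :
    IsBindingFamily U D L (deriv U (t - D)) ξbar (wealthLow U D L t' ξbar) := by
  rcases hLD.lt_or_eq with h | rfl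
  · exact isBindingFamily_wealthLow_of_lt hU hL h ht (ht' h) hξbar
  · exact isBindingFamily_wealthLow_self hU hL ht hξbar t'

lemma isBindingFamily_wealthMid (hU : IsUtility U) (hD : 0 < D) (hDL : D < L)
    (ht : IsTangentPoint U D t) (hLt : L ≤ t) (hξbar : 0 < ξbar) :
    IsBindingFamily U D L (deriv U (t - D)) ξbar (wealthMid U D L ξbar) := by
  have hL := hD.trans hDL
  have hl : 0 < L - D := sub_pos.2 hDL
  have hge : ∀ lam s, 0 < lam → 0 < s → s < deriv U (L - D) / lam →
      L ≤ inverseMarginal U (lam * s) + D := by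
    intro lam s hlam hs h
    rw [lt_div_iff₀ hlam, mul_comm] at h
    have := (hU.le_inverseMarginal_iff hl (mul_pos hlam hs)).2 h.le
    linarith
  have hkl : deriv U (t - D) ≤ deriv U (L - D) :=
    hU.deriv_strictAntiOn.antitoneOn hl (sub_pos.2 ht.1) (by linarith)
  refine ⟨fun lam hlam => ?_, fun lam hlam => ?_, fun x hx => ?_, fun lam hlam hk => ?_,
    fun lam x hlam hx => ?_, fun lam hlam hk => ?_⟩ <;> simp only [wealthMid_eq_threeRegion]
  · exact isProfile_threeRegion hU hD.le hL.le hlam _ _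
  · exact ⟨_, fun x hx hxK hxb => continuousAt_threeRegion hU hlam hx hxK hxb⟩
  · exact tendsto_threeRegion hx
  · rw [min_eq_right, threeRegion_self]
    rw [le_div_iff₀ hlam]
    linarith
  · exact max_sub_threeRegion hL.le (min_le_right _ _)
      (fun h => hge lam x hlam hx (h.trans_le (min_le_left _ _)))
  · rcases le_total (deriv U (L - D) / lam) ξbar with h | h
    · rw [min_eq_left h]
      have hbL : 0 < ξbar * L := mul_pos hξbar hL
      -- This λ₂ makes 0 and L indifferent at ξbar; it is nonnegative since U(L - D) ≤ U'(t - D) L ≤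
      -- λ ξbar L.
      refine ⟨lam - U (L - D) / (ξbar * L), ?_, fun s w hs hw =>
        lagrangian_le_threeRegion_mid hU hD ht hDL hLt hlam hξbar h ?_ hs hw⟩
      · rw [sub_nonneg, div_le_iff₀ hbL]
        have := ht.le_line hU hD hl.le
        rw [sub_add_cancel] at this
        nlinarith
      · field_simp
    · rw [min_eq_right h, threeRegion_self]
      refine exists_lagrangian_le_twoRegion hU hD hL ht hlam hξbar hk ?_
        (fun p q w hp _ hw => lagrangian_le_of_mid ht hU hD hDL hLt hp hw)
        (fun s hs hs' => hge lam s hlam hs (hs'.trans_le h))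
      have h1 : 0 ≤ conjugate U (lam * ξbar) := hU.conjugate_nonneg (mul_pos hlam hξbar)
      have h2 : 0 < lam * ξbar := mul_pos hlam hξbar
      nlinarith

end Families

/-! ### Solution of the two main cases -/

namespace IsProblem

variable {Ω : Type*} [MeasurableSpace Ω] {P : Measure Ω} [IsFiniteMeasure P] {ξ : Ω → ℝ}
  {U : ℝ → ℝ} {D L ε t ξbar x₀ : ℝ} {W : ℝ → ℝ → ℝ}

/-- The solution when the level `L` does not exceed the tangent point. -/
theorem optimal_of_level_le (h : IsProblem P ξ U D L ε) (ht : IsTangentPoint U D t) (hLt : L ≤ t)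
    (hξbar : IsDefaultThreshold P ξ L ε ξbar)
    (hW : IsBindingFamily U D L (deriv U (t - D)) ξbar W)
    (hlim : ∃ μ, ∀ s w, 0 < s → 0 ≤ w → w ≤ L → lagrangian U D L (μ * s) (0 * s) w ≤
      lagrangian U D L (μ * s) (0 * s) (wealthLimit L ξbar s))
    (hx₀ : L * ∫ ω, ξ ω ∂P - ε ≤ x₀) :
    (x₀ < price P ξ (fun ω => twoRegion U D ξbar (deriv U (t - D) / ξbar) (ξ ω)) →
      (L * ∫ ω, ξ ω ∂P - ε < x₀ →
        ∃ lam, 0 < lam ∧ price P ξ (fun ω => W lam (ξ ω)) = x₀) ∧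
      (∀ lam, 0 < lam → price P ξ (fun ω => W lam (ξ ω)) = x₀ →
        IsOptimal P ξ U D L ε x₀ (fun ω => W lam (ξ ω))) ∧
      (x₀ = L * ∫ ω, ξ ω ∂P - ε →
        IsOptimal P ξ U D L ε x₀ (fun ω => wealthLimit L ξbar (ξ ω)))) ∧
    (price P ξ (fun ω => twoRegion U D ξbar (deriv U (t - D) / ξbar) (ξ ω)) ≤ x₀ →
      (∃ lam, 0 < lam ∧ price P ξ (fun ω => benchmark U D t lam (ξ ω)) = x₀) ∧
      (∀ lam, 0 < lam → price P ξ (fun ω => benchmark U D t lam (ξ ω)) = x₀ →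
        IsOptimal P ξ U D L ε x₀ (fun ω => benchmark U D t lam (ξ ω)))) := by
  obtain ⟨hb, hpb⟩ := h.isDefaultThreshold_iff.1 hξbar
  have hU := h.utility
  have hk := ht.slope_pos hU
  have hL := h.L_pos
  -- For this multiplier the benchmark defaults exactly from ξbar on and coincides with the member
  -- of the binding family, so the two regimes of x₀ meet here.
  set lam₁ := deriv U (t - D) / ξbar with hlam₁
  have h₁ : 0 < lam₁ := div_pos hk hb
  have hk₁ : deriv U (t - D) / lam₁ = ξbar := div_div_cancel₀ hk.ne'
  have hW₁ : W lam₁ = twoRegion U D ξbar lam₁ :=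
    hW.eq_twoRegion _ h₁ (div_mul_cancel₀ _ hb.ne').le
  refine ⟨fun hlt => ⟨fun hgt => ?_, fun lam hlam hp => ?_, ?_⟩, fun hle => ?_⟩
  · refine exists_price_eq h.kernel hU h.integrable_wealth h.D_pos.le hL.le (S := Ioi 0)
      (fun _ hl => hl) isPreconnected_Ioi (Ioi_mem_atTop 0) (fun l hl => hW.profile l hl)
      (fun l hl => ?_) hW.tendsto (lam₁ := lam₁) h₁ (by rw [hW₁]; exact hlt.le) (by rwa [hpb])
    obtain ⟨c, hc⟩ := hW.continuousAt l hl
    filter_upwards [h.kernel.pos, h.kernel.ne c, h.kernel.ne ξbar] with ω h0 h1 h2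
      using hc _ h0 h1 h2
  · have hle : deriv U (t - D) ≤ lam * ξbar := by
      by_contra! hcon
      have hll : lam < lam₁ := by rwa [hlam₁, lt_div_iff₀ hb]
      rw [hW.eq_twoRegion lam hlam hcon.le] at hp
      have := h.price_mono (isProfile_twoRegion hU h.D_pos.le hL.le h₁ ξbar) h₁
        (isProfile_twoRegion hU h.D_pos.le hL.le hlam ξbar) hlam (fun x hx => by
          refine indicator_le_indicator ?_
          have := hU.inverseMarginal_le (mul_pos hlam hx)
            (mul_le_mul_of_nonneg_right hll.le hx.le)
          linarith)
      linarith
    obtain ⟨lam₂, h0, hmax⟩ := hW.lagrangian_le lam hlam hle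
    have hsf := h.shortfall_eq_sub_price (W := W lam) (isProfile_wealthLimit hL.le ξbar) one_pos
      (fun x hx => hW.shortfall lam x hlam hx)
    have hsf' : shortfall P ξ L (fun ω => W lam (ξ ω)) = ε := by
      rw [hsf, hpb]
      ring
    exact h.isOptimal hlam (hW.profile lam hlam) hp hsf'.le h0 (Or.inr hsf') hmax
  · rintro rfl
    obtain ⟨μ, hμ⟩ := hlim
    exact h.isOptimal_of_le one_pos (isProfile_wealthLimit hL.le ξbar)
      (fun x _ => indicator_le_self' (fun _ _ => hL.le) x) hpb hμ
  · refine h.benchmark_optimal ht h₁ hx₀ ?_ ?_ fun lam hlam hlle => ?_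
    · rw [hk₁, hpb]
      exact sub_pos.2 h.ε_lt
    · simpa only [benchmark, hk₁] using hle
    · have := h.shortfall_le_sub_price (isProfile_wealthLimit hL.le ξbar) one_pos
        (h.isProfile_benchmark (t := t) hlam) (fun x hx => by
          have hp := mul_pos hlam hx
          have hbk : ξbar ≤ deriv U (t - D) / lam := by
            rw [← hk₁]
            gcongr
          simp only [benchmark, twoRegion, wealthLimit, indicator_apply, mem_Iio]
          rcases lt_or_ge x (deriv U (t - D) / lam) with hlt | hge
          · rw [if_pos hlt]
            rw [lt_div_iff₀ hlam, mul_comm] at hlt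
            have := (hU.le_inverseMarginal_iff (sub_pos.2 ht.1) hp).2 hlt.le
            rw [max_eq_right (by linarith)]
            split_ifs <;> linarith
          · rw [if_neg (not_lt.2 hge), if_neg (not_lt.2 (hbk.trans hge)), max_eq_left (by linarith)])
      rwa [hpb, sub_sub_cancel] at this

/-- The solution when the level `L` exceeds the tangent point. -/
theorem optimal_of_lt_level (h : IsProblem P ξ U D L ε) (ht : IsTangentPoint U D t) (htL : t < L)
    {lbar : ℝ} (hlbar : IsCriticalMultiplier P ξ U D t L ε lbar)
    (hx₀ : L * ∫ ω, ξ ω ∂P - ε ≤ x₀) :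
    (x₀ < price P ξ (fun ω => benchmark U D t lbar (ξ ω)) →
      (L * ∫ ω, ξ ω ∂P - ε < x₀ →
        ∃ lam lam₂, 0 ≤ lam₂ ∧ lam₂ < lam ∧
          price P ξ (fun ω => wealthHigh U D t L lam lam₂ (ξ ω)) = x₀ ∧
          shortfall P ξ L (fun ω => wealthHigh U D t L lam lam₂ (ξ ω)) = ε) ∧
      (∀ lam lam₂, 0 ≤ lam₂ → lam₂ < lam →
        price P ξ (fun ω => wealthHigh U D t L lam lam₂ (ξ ω)) = x₀ →
        shortfall P ξ L (fun ω => wealthHigh U D t L lam lam₂ (ξ ω)) = ε →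
        IsOptimal P ξ U D L ε x₀ (fun ω => wealthHigh U D t L lam lam₂ (ξ ω))) ∧
      (x₀ = L * ∫ ω, ξ ω ∂P - ε →
        IsOptimal P ξ U D L ε x₀ (fun ω => wealthHighLimit U D t L lbar (ξ ω)))) ∧
    (price P ξ (fun ω => benchmark U D t lbar (ξ ω)) ≤ x₀ →
      (∃ lam, 0 < lam ∧ price P ξ (fun ω => benchmark U D t lam (ξ ω)) = x₀) ∧
      (∀ lam, 0 < lam → price P ξ (fun ω => benchmark U D t lam (ξ ω)) = x₀ →
        IsOptimal P ξ U D L ε x₀ (fun ω => benchmark U D t lam (ξ ω)))) := by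
  obtain ⟨hb, hpb⟩ := (h.isCriticalMultiplier_iff ht htL).1 hlbar
  have hU := h.utility
  have hD := h.D_pos
  have hL := h.L_pos
  have hlimp := isProfile_wealthHighLimit hU hD ht htL hb
  refine ⟨fun hlt => ⟨fun hgt => ?_, fun lam lam₂ h0 hlam hp hsf => ?_, ?_⟩, fun hle => ?_⟩
  · have hS : ∀ l ∈ Ici lbar, 0 < l := fun l hl => hb.trans_le hl
    have hcz : ∀ c : ℝ, ∀ l, 0 < l → ContinuousAt (fun l => c / l) l :=
      fun c l hl => continuousAt_const.div continuousAt_id hl.ne'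
    -- The difference λ - λ₂ is frozen at `lbar`, which fixes the shortfall at ε. The family starts
    -- at λ₂ = 0 with the benchmark and tends to the limit wealth, whose price is the minimal
    -- capital.
    obtain ⟨lam, hlam, hp⟩ := exists_price_eq h.kernel hU h.integrable_wealth hD.le hL.le
      (W := fun l => wealthHigh U D t L l (l - lbar)) (S := Ici lbar)
      (V := wealthHighLimit U D t L lbar) (lam₁ := lbar) (x₀ := x₀) hS isPreconnected_Ici
      (Ici_mem_atTop lbar)
      (fun l hl => isProfile_wealthHigh hU hD ht htL (sub_nonneg.2 hl) (by linarith))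
      (fun l hl => by
        filter_upwards [h.kernel.pos, h.kernel.ne (deriv U (L - D) / l),
          h.kernel.ne (deriv U (L - D) / lbar), h.kernel.ne (deriv U (t - D) / lbar)]
          with ω h0 h1 h2 h3
        simp only [wealthHigh, sub_sub_cancel]
        exact ((continuousAt_indicator_Iio (g := fun l x => inverseMarginal U (l * x) + D)
          (hcz _ l (hS l hl)) h1 (hU.continuousAt_inverseMarginal_mul (hS l hl) h0 D)).add
          (continuousAt_indicator_Ico (b := fun _ => deriv U (L - D) / lbar) (hcz _ l (hS l hl)) h1
            continuousAt_const h2 continuousAt_const)).add continuousAt_const)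
      (fun x hx => by
        refine tendsto_const_nhds.congr' ?_
        filter_upwards [eventually_ge_atTop (deriv U (L - D) / x), eventually_ge_atTop lbar]
          with l hl hl'
        rw [div_le_iff₀ hx] at hl
        have hx' : deriv U (L - D) / l ≤ x := by rwa [div_le_iff₀ (hS l hl'), mul_comm]
        simp only [wealthHigh, wealthHighLimit, sub_sub_cancel, indicator_apply, mem_Iio, mem_Ico,
          not_lt.2 hx', hx', if_false, true_and, zero_add])
      self_mem_Ici (by
        refine hlt.le.trans (le_of_eq (integral_congr_ae ?_))
        filter_upwards [h.kernel.pos] with ω hω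
        rw [sub_self, wealthHigh_zero hU ht htL hb hω])
      (by rwa [hpb])
    refine ⟨lam, lam - lbar, sub_nonneg.2 hlam, by linarith, hp, ?_⟩
    have := h.shortfall_eq_sub_price (W := wealthHigh U D t L lam (lam - lbar)) hlimp hb
      (fun x hx => by
        rw [max_sub_wealthHigh hU hD ht htL (sub_nonneg.2 hlam) (by linarith) hx, sub_sub_cancel])
    rw [this, hpb]
    ring
  · exact h.isOptimal (h0.trans_lt hlam) (isProfile_wealthHigh hU hD ht htL h0 hlam) hp hsf.le h0
      (Or.inr hsf) fun s w hs hw => lagrangian_le_wealthHigh hU hD ht htL h0 hlam hs hw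
  · rintro rfl
    exact h.isOptimal_of_le hb hlimp (fun x hx => wealthHighLimit_le hU hD ht htL hb hx) hpb
      fun s w hs hw hwL => lagrangian_le_wealthHighLimit hU hD ht htL hb hs hw hwL
  · refine h.benchmark_optimal ht hb hx₀ ?_ hle fun lam hlam hlle => ?_
    · refine (sub_pos.2 h.ε_lt).trans_le (hpb.ge.trans ?_)
      refine h.price_mono hlimp hb (isProfile_wealthLimit hL.le _) one_pos fun x hx => ?_
      have hkl := ht.deriv_lt hU htL
      simp only [wealthLimit, indicator_apply, mem_Iio, lt_div_iff₀ hb, mul_comm x]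
      rcases wealthHighLimit_cases hU ht htL hb x with ⟨g, e⟩ | ⟨g, g', e⟩ | ⟨g, e⟩
      · rw [if_pos (g.trans hkl)]
        exact wealthHighLimit_le hU hD ht htL hb hx
      · rw [if_pos g']
        exact wealthHighLimit_le hU hD ht htL hb hx
      · rw [if_neg (not_lt.2 g), e]
    · have := h.shortfall_le_sub_price hlimp hb (h.isProfile_benchmark (t := t) hlam)
        (fun x hx => by
          have h1 := max_sub_wealthHigh hU hD ht htL le_rfl hb hx
          rw [wealthHigh_zero hU ht htL hb hx, sub_zero] at h1
          rw [← h1]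
          exact max_le_max (sub_le_sub_left (benchmark_le hU hD.le hlam hlle hx) _) le_rfl)
      rwa [hpb, sub_sub_cancel] at this

end IsProblem

end SurplusES

theorem theorem4p1 {Ω : Type*} [MeasurableSpace Ω] (P Q : Measure Ω)
    [IsProbabilityMeasure P] [IsProbabilityMeasure Q] (hPQ : P ≪ Q) (hQP : Q ≪ P)
    (T : ℝ) (hT : 0 < T) (r : ℝ → ℝ) (hr : IntervalIntegrable r volume 0 T)
    (ξ : Ω → ℝ) (hξ : ξ = statePriceDensity P Q r T)
    (hatom : ∀ c : ℝ, P {ω | ξ ω = c} = 0)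
    (U : ℝ → ℝ) (hU : IsUtility U)
    (hUI : ∀ lam : ℝ, 0 < lam → Integrable (fun ω => U (inverseMarginal U (lam * ξ ω))) P)
    (hξI : ∀ lam : ℝ, 0 < lam → Integrable (fun ω => ξ ω * inverseMarginal U (lam * ξ ω)) P)
    (D L ε : ℝ) (hD : 0 < D) (hL : 0 < L) (hε : 0 < ε)
    (hεL : ε < L * Real.exp (-∫ s in (0 : ℝ)..T, r s)) :
    -- the auxiliary quantities exist
    (∃! Dhat, IsTangentPoint U D Dhat) ∧
    (L < D → ∃! Ltilde, IsTangentPoint U (D - L) Ltilde) ∧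
    (∃ ξbar, IsDefaultThreshold P ξ L ε ξbar) ∧
    (∀ Dhat, IsTangentPoint U D Dhat → Dhat < L →
      ∃ lbar, IsCriticalMultiplier P ξ U D Dhat L ε lbar) ∧
    ∀ Dhat, IsTangentPoint U D Dhat →
    ∀ x₀min, x₀min = L * Real.exp (-∫ s in (0 : ℝ)..T, r s) - ε →
    ∀ x₀, x₀min ≤ x₀ →
      -- a) `L ≤ D`
      (L ≤ D →
        ∀ Ltilde, (L < D → IsTangentPoint U (D - L) Ltilde) →
        ∀ ξbar, IsDefaultThreshold P ξ L ε ξbar →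
        ∀ x₁, x₁ = price P ξ (fun ω =>
            twoRegion U D ξbar (deriv U (Dhat - D) / ξbar) (ξ ω)) →
          (x₀ < x₁ →
            (x₀min < x₀ →
              ∃ lam, 0 < lam ∧ price P ξ (fun ω => wealthLow U D L Ltilde ξbar lam (ξ ω)) = x₀) ∧
            (∀ lam, 0 < lam →
              price P ξ (fun ω => wealthLow U D L Ltilde ξbar lam (ξ ω)) = x₀ →
              IsOptimal P ξ U D L ε x₀ (fun ω => wealthLow U D L Ltilde ξbar lam (ξ ω))) ∧
            (x₀ = x₀min → IsOptimal P ξ U D L ε x₀ (fun ω => wealthLimit L ξbar (ξ ω)))) ∧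
          (x₁ ≤ x₀ →
            (∃ lam, 0 < lam ∧ price P ξ (fun ω => benchmark U D Dhat lam (ξ ω)) = x₀) ∧
            (∀ lam, 0 < lam → price P ξ (fun ω => benchmark U D Dhat lam (ξ ω)) = x₀ →
              IsOptimal P ξ U D L ε x₀ (fun ω => benchmark U D Dhat lam (ξ ω))))) ∧
      -- b) `D < L ≤ Dhat`
      (D < L → L ≤ Dhat →
        ∀ ξbar, IsDefaultThreshold P ξ L ε ξbar →
        ∀ x₂, x₂ = price P ξ (fun ω =>
            twoRegion U D ξbar (deriv U (Dhat - D) / ξbar) (ξ ω)) →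
          (x₀ < x₂ →
            (x₀min < x₀ →
              ∃ lam, 0 < lam ∧ price P ξ (fun ω => wealthMid U D L ξbar lam (ξ ω)) = x₀) ∧
            (∀ lam, 0 < lam → price P ξ (fun ω => wealthMid U D L ξbar lam (ξ ω)) = x₀ →
              IsOptimal P ξ U D L ε x₀ (fun ω => wealthMid U D L ξbar lam (ξ ω))) ∧
            (x₀ = x₀min → IsOptimal P ξ U D L ε x₀ (fun ω => wealthLimit L ξbar (ξ ω)))) ∧
          (x₂ ≤ x₀ →
            (∃ lam, 0 < lam ∧ price P ξ (fun ω => benchmark U D Dhat lam (ξ ω)) = x₀) ∧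
            (∀ lam, 0 < lam → price P ξ (fun ω => benchmark U D Dhat lam (ξ ω)) = x₀ →
              IsOptimal P ξ U D L ε x₀ (fun ω => benchmark U D Dhat lam (ξ ω))))) ∧
      -- c) `Dhat < L`
      (Dhat < L →
        ∀ lbar, IsCriticalMultiplier P ξ U D Dhat L ε lbar →
        ∀ x₃, x₃ = price P ξ (fun ω => benchmark U D Dhat lbar (ξ ω)) →
          (x₀ < x₃ →
            (x₀min < x₀ →
              ∃ lam lam₂, 0 ≤ lam₂ ∧ lam₂ < lam ∧
                price P ξ (fun ω => wealthHigh U D Dhat L lam lam₂ (ξ ω)) = x₀ ∧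
                shortfall P ξ L (fun ω => wealthHigh U D Dhat L lam lam₂ (ξ ω)) = ε) ∧
            (∀ lam lam₂, 0 ≤ lam₂ → lam₂ < lam →
              price P ξ (fun ω => wealthHigh U D Dhat L lam lam₂ (ξ ω)) = x₀ →
              shortfall P ξ L (fun ω => wealthHigh U D Dhat L lam lam₂ (ξ ω)) = ε →
              IsOptimal P ξ U D L ε x₀ (fun ω => wealthHigh U D Dhat L lam lam₂ (ξ ω))) ∧
            (x₀ = x₀min →
              IsOptimal P ξ U D L ε x₀ (fun ω => wealthHighLimit U D Dhat L lbar (ξ ω)))) ∧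
          (x₃ ≤ x₀ →
            (∃ lam, 0 < lam ∧ price P ξ (fun ω => benchmark U D Dhat lam (ξ ω)) = x₀) ∧
            (∀ lam, 0 < lam → price P ξ (fun ω => benchmark U D Dhat lam (ξ ω)) = x₀ →
              IsOptimal P ξ U D L ε x₀ (fun ω => benchmark U D Dhat lam (ξ ω))))) := by
  subst hξ
  have hk := isPricingKernel_statePriceDensity hatom
  have hint := integral_statePriceDensity hQP r T
  have hp : IsProblem P (statePriceDensity P Q r T) U D L ε :=
    ⟨hk, hU, hUI, hξI, hD, hL, hε, by rwa [hint]⟩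
  refine ⟨hU.existsUnique_isTangentPoint hD,
    fun h => hU.existsUnique_isTangentPoint (sub_pos.2 h), hp.exists_isDefaultThreshold,
    fun t ht htL => hp.exists_isCriticalMultiplier ht htL, ?_⟩
  rintro t ht _ rfl x₀ hx₀
  rw [← hint] at hx₀ ⊢
  refine ⟨?_, ?_, ?_⟩
  · rintro hLD t' ht' ξbar hξbar _ rfl
    exact hp.optimal_of_level_le ht (hLD.trans ht.1.le) hξbar
      (isBindingFamily_wealthLow hU hL hLD ht ht' hξbar.1)
      ⟨0, fun s w _ _ hwL => lagrangian_le_wealthLimit_low hU hLD hwL⟩ hx₀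
  · rintro hDL hLt ξbar hξbar _ rfl
    exact hp.optimal_of_level_le ht hLt hξbar
      (isBindingFamily_wealthMid hU hD hDL ht hLt hξbar.1)
      ⟨_, fun s w hs hw hwL => lagrangian_le_wealthLimit_mid hU hD ht hDL hLt hξbar.1 hs hw hwL⟩ hx₀
  · rintro htL lbar hlbar _ rfl
    exact hp.optimal_of_lt_level ht htL hlbar hx₀
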